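/- **Abstract first-order CLT.** Let $E$ be a locally compact separable metric space and let $(P_t)_{t\ge 0}$ be the semigroup of Markov kernels of a Feller process on $E$ ($P_t$ maps $\mathcal C_0(E)$ to itself, $P_0=\mathrm{Id}$, $P_{t+s}=P_tP_s$, $\|P_tf-f\|_\infty\to 0$ as $t\to0$ for $f\in \mathcal C_0(E)$), with an invariant probability measure $\nu$. For a Borel function $f$ such that $P_tf(x)$ exists for small $t$ write $Af(x)=\lim_{t\to 0}(P_tf(x)-f(x))/t$ when this limit exists for every $x$ (this extends the strong generator on $\mathcal C_0(E)$). Let $(Q_\gamma)$ be Markov kernels on $E$, let $\gamma_n>0$ $(n\ge 1)$ satisfy $\gamma_n\to 0$ and $\sum_n\gamma_n=\infty$, let $\overline\gamma=\sup_n\gamma_n$, and let $(X_n)_{n\ge 0}$ be a Markov chain on a probability space $(\Omega,\mathcal G,\mathbb P)$ with transition $Q_{\gamma_{n+1}}$ from time $n$ to time $n+1$. For weights $w_n\ge 0$ put $H_{w,n}=\sum_{k=1}^n w_k$ and $\nu_n^w=H_{w,n}^{-1}\sum_{k=1}^n w_k\delta_{X_{k-1}}$. For a function $\epsilon:\mathbb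 R_+\to\mathbb R_+$ write $H_{\epsilon,n}$, $\nu^\epsilon_n$ for the weights $w_n=\epsilon(\gamma_n)$. Let $F$ be a set of Borel functions $f:E\to\mathbb R$ for which $Af$ is defined, continuous and bounded. Let $\mathfrak M_1$ and $\mathfrak V$ be maps (not necessarily linear) which send $f\in F$ to real functions on $E$, with $\mathfrak M_1f,\mathfrak Vf\in L^1(\nu)$. Let $g:E\to\mathbb R_+$ be Borel, $\rho\in[1,2]$, and let $\tilde\eta_1,\epsilon_{\mathfrak X},\epsilon_{\mathcal{GC}}:\mathbb R_+\to\mathbb R_+$ be nondecreasing with $H_{\tilde\eta_1,n}\to\infty$ and $H_{\epsilon_{\mathfrak X},n}\to\infty$. Let $\eta_n=C\gamma_n$ with $C>0$, and $H_n=H_{\eta,n}$. Let $(\tilde\Omega,\tilde{\mathcal G},\tilde{\mathbb P})$ be a probability space. Assume the following for every $f\in F$. 1. *(Weak error expansion $\mathcal E_1$.)* $f\in L^1(Q_\gamma(x,\cdot))$ for all $x\in E$, $\gamma\in(0,\overline\gamma]$; $\nu_n^{\tilde\eta_1}(\mathfrak M_1f)\to\nu(\mathfrak M_1f)$ a.s.;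 and for all $x\in E$, $\gamma\in(0,\overline\gamma]$, $$\bigl|-\bigl(Q_\gamma f(x)-f(x)-\gamma Af(x)\bigr)-\tilde\eta_1(\gamma)\mathfrak M_1f(x)\bigr|\le\tilde\eta_1(\gamma)\Lambda_f(x,\gamma),\qquad \Lambda_f(x,\gamma)=\sum_{i=1}^l g_i(x)\,\tilde{\mathbb E}[\tilde\Lambda_i(x,\gamma)],$$ where $(g_i)_{i\le l}$ are locally bounded Borel functions $E\to\mathbb R_+$ and $\tilde\Lambda:E\times\mathbb R_+\times\tilde\Omega\to\mathbb R_+^l$ is measurable (these may depend on $f$), and for each $i$: $\tilde{\mathbb E}[\sup_{x\in E}\sup_{\gamma\in(0,\overline\gamma]}\tilde\Lambda_i(x,\gamma)]<\infty$; $\sup_n\nu_n^{\tilde\eta_1}(g_i)<\infty$ a.s.; and either (I) there is a measurable $\underline\gamma:\tilde\Omega\to(0,\overline\gamma]$ such that $\tilde{\mathbb P}$-a.s. $\lim_{\gamma\to0}\sup_{x\in K}\tilde\Lambda_i(x,\gamma,\tilde\omega)=0$ for every compact $K$ and $\lim_{x\to\infty}\sup_{\gamma\in(0,\underline\gamma(\tilde\omega)]}\tilde\Lambda_i(x,\gamma,\tilde\omega)=0$,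 or (II) $\tilde{\mathbb P}$-a.s. $\lim_{\gamma\to0}\sup_{x\in E}\tilde\Lambda_i(x,\gamma,\tilde\omega)g_i(x)=0$. 2. *(Growth control $\mathcal{GC}_{Q,1}$.)* There are $\mathscr X_{n}\in L^2(\mathbb P)$, $n\ge1$, with $\mathscr X_{n}$ measurable with respect to $\sigma(X_0,\dots,X_{n})$, and a constant $C_f>0$, such that for every $n\ge0$, a.s., $\mathbb E[\mathscr X_{n+1}\mid X_n]=0$, $\mathbb E[\mathscr X_{n+1}^2\mid X_n]=\epsilon_{\mathfrak X}(\gamma_{n+1})\mathfrak Vf(X_n)$ and $$\mathbb E\bigl[\,\bigl|-(f(X_{n+1})-Q_{\gamma_{n+1}}f(X_n))-\mathscr X_{n+1}\bigr|^\rho\,\big|\,X_n\bigr]\le C_f\,\epsilon_{\mathcal{GC}}(\gamma_{n+1})\,g(X_n);$$ moreover $\nu_n^{\epsilon_{\mathfrak X}}(\mathfrak Vf)\to\nu(\mathfrak Vf)$ a.s., and the Lindeberg condition holds: for every $e>0$, $H_{\epsilon_{\mathfrak X},n}^{-1}\sum_{k=0}^{n-1}\mathbb E[\mathscr X_{k+1}^2\mathbf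 1_{\{|\mathscr X_{k+1}|>e\sqrt{H_{\epsilon_{\mathfrak X},n}}\}}\mid X_k]\to0$ in probability. 3. *(Step weights.)* Almost surely $\sum_{n\ge1}\epsilon_{\mathcal{GC}}(\gamma_n)H_{\epsilon_{\mathfrak X},n}^{-\rho/2}\,g(X_{n-1})<\infty$ (the finitely many terms with $H_{\epsilon_{\mathfrak X},n}=0$ being omitted). 4. *(Endpoint.)* Either $f$ is bounded (for instance $f\in\mathcal C_0(E)$), or $f(X_n)/\sqrt{H_{\epsilon_{\mathfrak X},n}}\to0$ in probability, and almost surely if $\mathfrak Vf=0$. Then, for every $f\in F$: A. If $\sqrt{H_{\epsilon_{\mathfrak X},n}}/H_{\tilde\eta_1,n}\to+\infty$, then $\dfrac{H_n}{C\sqrt{H_{\epsilon_{\mathfrak X},n}}}\,\nu_n^\eta(Af)\to\mathcal N(0,\nu(\mathfrak Vf))$ in law. B. If $\sqrt{H_{\epsilon_{\mathfrak X},n}}/H_{\tilde\eta_1,n}\to\hat l\in(0,\infty)$, then $\dfrac{H_n}{C\sqrt{H_{\epsilon_{\mathfrak X},n}}}\,\nu_n^\eta(Af)\to\mathcal N(\hat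 l^{-1}\nu(\mathfrak M_1f),\nu(\mathfrak Vf))$ in law. C. If $\sqrt{H_{\epsilon_{\mathfrak X},n}}/H_{\tilde\eta_1,n}\to0$, then $\dfrac{H_n}{C\,H_{\tilde\eta_1,n}}\,\nu_n^\eta(Af)\to\nu(\mathfrak M_1f)$ in probability; if moreover $\mathfrak Vf=0$, the convergence is almost sure. -/

import Mathlib

open MeasureTheory ProbabilityTheory Filter Topology
open scoped NNReal ENNReal

namespace ErgodicCLT

/-! ### Feller semigroups and their generator -/

section Feller

variable {E : Type*} [MetricSpace E] [MeasurableSpace E]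

/-- `P` is the (conservative) transition semigroup of a Feller process on `E`: it maps the space
`C₀(E)` to itself, `P 0` is the identity, the Chapman-Kolmogorov equation holds, and
`‖P t f - f‖_∞ → 0` as `t → 0` for `f` in `C₀(E)`. -/
structure IsFellerSemigroup (P : ℝ≥0 → Kernel E E) : Prop where
  markov : ∀ t, IsMarkovKernel (P t)
  zero : P 0 = Kernel.id
  add : ∀ s t, P (s + t) = P t ∘ₖ P s
  map_zeroAtInfty : ∀ (t : ℝ≥0) (f : ZeroAtInftyContinuousMap E ℝ),
    ∃ h : ZeroAtInftyContinuousMap E ℝ, ∀ x, h x = ∫ y, f y ∂(P t x)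
  strongly_continuous : ∀ f : ZeroAtInftyContinuousMap E ℝ,
    TendstoUniformly (fun (t : ℝ≥0) (x : E) => ∫ y, f y ∂(P t x)) f (𝓝 0)

/-- Functions on which the generator is evaluated: Borel functions `f`, possibly unbounded and
outside of `C₀(E)`, such that for every `x` the expectation `P t f x` exists for small `t` and
`(P t f x - f x) / t` converges as `t → 0`. -/
def generatorDomain (P : ℝ≥0 → Kernel E E) : Set (E → ℝ) :=
  {f | Measurable f ∧ ∀ x, (∀ᶠ t in 𝓝[>] (0 : ℝ≥0), Integrable f (P t x)) ∧
    ∃ a : ℝ, Tendsto (fun t : ℝ≥0 => ((∫ y, f y ∂(P t x)) - f x) / (t : ℝ)) (𝓝[>] 0) (𝓝 a)}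

/-- The infinitesimal generator `A f (x) = lim_{t → 0} (P t f x - f x) / t`, meaningful for
`f ∈ generatorDomain P`. -/
noncomputable def generator (P : ℝ≥0 → Kernel E E) (f : E → ℝ) (x : E) : ℝ :=
  limUnder (𝓝[>] (0 : ℝ≥0)) (fun t : ℝ≥0 => ((∫ y, f y ∂(P t x)) - f x) / (t : ℝ))

/-- On the domain of the strong generator, where the limit exists in the sup norm of `C₀(E)`,
`generator` is the strong generator. -/
theorem generator_eq_of_tendstoUniformly [BorelSpace E] {P : ℝ≥0 → Kernel E E}
    (hP : IsFellerSemigroup P) (f h : ZeroAtInftyContinuousMap E ℝ)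
    (hfh : TendstoUniformlyOnFilter
      (fun (t : ℝ≥0) (x : E) => ((∫ y, f y ∂(P t x)) - f x) / (t : ℝ)) h (𝓝[>] 0) ⊤) :
    (f : E → ℝ) ∈ generatorDomain P ∧ generator P f = h := by
  have hlim : ∀ x, Tendsto (fun t : ℝ≥0 => ((∫ y, f y ∂(P t x)) - f x) / (t : ℝ))
      (𝓝[>] 0) (𝓝 (h x)) := fun x => hfh.tendsto_at le_top
  refine ⟨⟨f.continuous.measurable, fun x => ⟨Eventually.of_forall fun t => ?_, h x, hlim x⟩⟩,
    funext fun x => (hlim x).limUnder_eq⟩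
  have := hP.markov t
  exact Integrable.of_bound f.continuous.measurable.aestronglyMeasurable ‖f.toBCF‖
    (Eventually.of_forall fun y => f.toBCF.norm_coe_le_norm y)

end Feller

/-! ### Steps, weights and weighted empirical measures

Sequences are indexed by `n ≥ 1`; their value at `0` plays no role. -/

/-- `H_{w,n} = w_1 + ⋯ + w_n`. -/
noncomputable def partialSum (w : ℕ → ℝ≥0) (n : ℕ) : ℝ≥0 := ∑ k ∈ Finset.Icc 1 n, w k

/-- `γ̄ = sup_{n ≥ 1} γ_n`. -/
noncomputable def supStep (γ : ℕ → ℝ≥0) : ℝ≥0 := ⨆ n : ℕ, γ (n + 1)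

/-- Nonnegative weights with `H_{w,n} → ∞`. -/
def IsWeightSequence (w : ℕ → ℝ≥0) : Prop := Tendsto (partialSum w) atTop atTop

/-- Positive steps with `γ_n → 0` (hence bounded) and `γ_1 + ⋯ + γ_n → ∞`. -/
structure IsStepSequence (γ : ℕ → ℝ≥0) : Prop where
  pos : ∀ n, 1 ≤ n → 0 < γ n
  tendsto_zero : Tendsto γ atTop (𝓝 0)
  sum_tendsto : IsWeightSequence γ

section Chain

variable {Ω E : Type*} [MeasurableSpace Ω] [MeasurableSpace E]

/-- `σ(X_0, …, X_n)`. -/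
abbrev history (X : ℕ → Ω → E) (n : ℕ) : MeasurableSpace Ω :=
  ⨆ k ≤ n, MeasurableSpace.comap (X k) inferInstance

/-- `σ(X_n)`. -/
abbrev present (X : ℕ → Ω → E) (n : ℕ) : MeasurableSpace Ω :=
  MeasurableSpace.comap (X n) inferInstance

/-- `X_n` (the approximation at time `γ_1 + ⋯ + γ_n`) is a non-homogeneous Markov chain whose
transition from time `n` to time `n + 1` is `Q γ_{n+1}`. -/
structure IsMarkovScheme (μ : Measure Ω) (Q : ℝ≥0 → Kernel E E) (γ : ℕ → ℝ≥0)
    (X : ℕ → Ω → E) : Prop where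
  measurable : ∀ n, Measurable (X n)
  transition : ∀ (n : ℕ) (B : Set E), MeasurableSet B →
    μ⟦X (n + 1) ⁻¹' B | history X n⟧ =ᵐ[μ] fun ω => (Q (γ (n + 1)) (X n ω)).real B

/-- `ν_n^w = H_{w,n}⁻¹ ∑_{k=1}^n w_k δ_{X_{k-1}}`. -/
noncomputable def empiricalMeasure (w : ℕ → ℝ≥0) (X : ℕ → Ω → E) (n : ℕ) (ω : Ω) : Measure E :=
  (partialSum w n)⁻¹ • ∑ k ∈ Finset.Icc 1 n, w k • Measure.dirac (X (k - 1) ω)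

end Chain

theorem integral_empiricalMeasure {Ω E : Type*} [MeasurableSpace E] [MeasurableSingletonClass E] (w : ℕ → ℝ≥0) (X : ℕ → Ω → E)
    (n : ℕ) (ω : Ω) (f : E → ℝ) :
    ∫ x, f x ∂(empiricalMeasure w X n ω) =
      (partialSum w n : ℝ)⁻¹ * ∑ k ∈ Finset.Icc 1 n, (w k : ℝ) * f (X (k - 1) ω) := by
  unfold empiricalMeasure
  rw [integral_smul_nnreal_measure, integral_finsetSum_measure]
  · simp [integral_smul_nnreal_measure, NNReal.smul_def]
  · intro k _
    exact (integrable_dirac (by simp)).smul_measure_nnreal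

/-! ### First-order weak error expansion -/

section WeakError

variable {Ω E Ω' : Type*} [MeasurableSpace Ω] [MetricSpace E] [MeasurableSpace E]
  [MeasurableSpace Ω']

/-- The pseudo-generator `(Q γ f - f) / γ`. -/
noncomputable def pseudoGenerator (Q : ℝ≥0 → Kernel E E) (γ : ℝ≥0) (f : E → ℝ) (x : E) : ℝ :=
  ((∫ y, f y ∂(Q γ x)) - f x) / (γ : ℝ)

/-- The first-order remainder `γ Ã_γ f - γ A f`. -/
noncomputable def remainder (P Q : ℝ≥0 → Kernel E E) (f : E → ℝ) (x : E) (γ : ℝ≥0) : ℝ :=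
  (γ : ℝ) * pseudoGenerator Q γ f x - (γ : ℝ) * generator P f x

/-- First alternative for the error density `L : E × ℝ₊ × Ω' → ℝ₊`: almost surely, it tends to `0`
with the step, uniformly on compact sets, and it tends to `0` at infinity, uniformly over the
steps in `(0, γlow]`. -/
def LocalErrorCondition (P' : Measure Ω') (γbar : ℝ≥0) (L : E → ℝ≥0 → Ω' → ℝ≥0) : Prop :=
  ∃ γlow : Ω' → ℝ≥0, Measurable γlow ∧ (∀ ω', 0 < γlow ω' ∧ γlow ω' ≤ γbar) ∧
    ∀ᵐ ω' ∂P',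
      (∀ K : Set E, IsCompact K →
        Tendsto (fun γ : ℝ≥0 => ⨆ x ∈ K, (L x γ ω' : ℝ≥0∞)) (𝓝[>] 0) (𝓝 0)) ∧
      Tendsto (fun x : E => ⨆ γ ∈ Set.Ioc 0 (γlow ω'), (L x γ ω' : ℝ≥0∞)) (cocompact E) (𝓝 0)

/-- Second alternative: almost surely `sup_x L(x, γ) g(x) → 0` as `γ → 0`. -/
def UniformErrorCondition (P' : Measure Ω') (g : E → ℝ≥0) (L : E → ℝ≥0 → Ω' → ℝ≥0) : Prop :=
  ∀ᵐ ω' ∂P',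
    Tendsto (fun γ : ℝ≥0 => ⨆ x : E, ((L x γ ω' * g x : ℝ≥0) : ℝ≥0∞)) (𝓝[>] 0) (𝓝 0)

/-- The error bound `Λ(x, γ) = ∑ i, g_i(x) 𝔼'[L_i(x, γ)]` of the expansion, with all the
requirements on `g` and `L`. -/
structure IsErrorRepresentation (μ : Measure Ω) (P' : Measure Ω') (γ : ℕ → ℝ≥0) (X : ℕ → Ω → E)
    (ηt : ℝ≥0 → ℝ≥0) (Λ : E → ℝ≥0 → ℝ≥0) {l : ℕ} (g : E → Fin l → ℝ≥0)
    (L : E → ℝ≥0 → Ω' → Fin l → ℝ≥0) : Prop where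
  measurable_g : Measurable g
  locally_bounded : ∀ x : E, ∃ C : ℝ≥0, ∀ᶠ y in 𝓝 x, ∀ i, g y i ≤ C
  measurable_L : Measurable fun z : E × ℝ≥0 × Ω' => L z.1 z.2.1 z.2.2
  dominated : ∀ i, ∫⁻ ω', (⨆ x : E, ⨆ s ∈ Set.Ioc 0 (supStep γ), (L x s ω' i : ℝ≥0∞)) ∂P' < ∞
  eq_pairing : ∀ x : E, ∀ s ∈ Set.Ioc 0 (supStep γ),
    (Λ x s : ℝ) = ∑ i, (g x i : ℝ) * ∫ ω', (L x s ω' i : ℝ) ∂P'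
  empirical_bound : ∀ i, ∀ᵐ ω ∂μ, ∃ C : ℝ, ∀ n, 1 ≤ n →
    ∫ x, (g x i : ℝ) ∂(empiricalMeasure (fun k => ηt (γ k)) X n ω) ≤ C
  alternative : ∀ i, LocalErrorCondition P' (supStep γ) (fun x s ω' => L x s ω' i) ∨
    UniformErrorCondition P' (fun x => g x i) (fun x s ω' => L x s ω' i)

/-- First-order weak error expansion for the test function `f` with rate function `ηt` and
leading coefficient `Mf`. -/
structure WeakErrorExpansion (μ : Measure Ω) (P' : Measure Ω') (P Q : ℝ≥0 → Kernel E E)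
    (ν : Measure E) (γ : ℕ → ℝ≥0) (X : ℕ → Ω → E) (ηt : ℝ≥0 → ℝ≥0) (f Mf : E → ℝ) : Prop where
  integrable_Q : ∀ s ∈ Set.Ioc 0 (supStep γ), ∀ x, Integrable f (Q s x)
  integrable_M : Integrable Mf ν
  ergodic_M : ∀ᵐ ω ∂μ,
    Tendsto (fun n => ∫ x, Mf x ∂(empiricalMeasure (fun k => ηt (γ k)) X n ω)) atTop
      (𝓝 (∫ x, Mf x ∂ν))
  expansion : ∃ (Λ : E → ℝ≥0 → ℝ≥0) (l : ℕ) (g : E → Fin l → ℝ≥0)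
      (L : E → ℝ≥0 → Ω' → Fin l → ℝ≥0),
    IsErrorRepresentation μ P' γ X ηt Λ g L ∧
    ∀ x : E, ∀ s ∈ Set.Ioc 0 (supStep γ),
      |(-1) * remainder P Q f x s - (ηt s : ℝ) * Mf x| ≤ (ηt s : ℝ) * (Λ x s : ℝ)

end WeakError

/-! ### Growth control and step-weight condition -/

section Growth

variable {Ω E : Type*} [MeasurableSpace Ω] [MeasurableSpace E]

/-- Square-integrable processes `(Z_n)_{n ≥ 1}`, adapted to the filtration of the chain, with
`𝔼[Z_{n+1} | X_n] = 0`. -/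
structure IsCenteredL2Process (μ : Measure Ω) (X : ℕ → Ω → E) (Z : ℕ → Ω → ℝ) : Prop where
  adapted : ∀ n, Measurable[history X (n + 1)] (Z (n + 1))
  memLp : ∀ n, MemLp (Z (n + 1)) 2 μ
  centered : ∀ n, μ[Z (n + 1) | present X n] =ᵐ[μ] 0

/-- Conditional Lindeberg condition for `Z` with normalisation `√H_{w,n}`. -/
def LindebergCondition (μ : Measure Ω) (X : ℕ → Ω → E) (w : ℕ → ℝ≥0) (Z : ℕ → Ω → ℝ) : Prop :=
  ∀ e : ℝ, 0 < e → TendstoInMeasure μ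
    (fun (n : ℕ) (ω : Ω) => (partialSum w n : ℝ)⁻¹ * ∑ k ∈ Finset.range n,
      (μ[{ω' | √(partialSum w n : ℝ) * e < |Z (k + 1) ω'|}.indicator (fun ω' => Z (k + 1) ω' ^ 2) |
        present X k]) ω)
    atTop (fun _ => 0)

/-- First-order growth control for the test function `f`: up to an error whose conditional moment
of order `ρ` is controlled by `εGC` and `g`, the increments `-(f(X_{n+1}) - Q f(X_n))` are those of
a centred process `Z` with conditional variance `εX(γ_{n+1}) Vf(X_n)`. The conditional moment is
the `[0,∞]`-valued conditional expectation. -/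
def GrowthControl (μ : Measure Ω) (Q : ℝ≥0 → Kernel E E) (ν : Measure E) (γ : ℕ → ℝ≥0)
    (X : ℕ → Ω → E) (g : E → ℝ≥0) (ρ : ℝ) (εX εGC : ℝ≥0 → ℝ≥0) (f Vf : E → ℝ) : Prop :=
  ∃ Z : ℕ → Ω → ℝ, IsCenteredL2Process μ X Z ∧
    (∃ C : ℝ≥0, 0 < C ∧ ∀ n,
      condLExp (present X n) μ
        (fun ω => ENNReal.ofReal
          (|-(f (X (n + 1) ω) - ∫ y, f y ∂(Q (γ (n + 1)) (X n ω))) - Z (n + 1) ω| ^ ρ))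
      ≤ᵐ[μ] fun ω => ((C * εGC (γ (n + 1)) * g (X n ω) : ℝ≥0) : ℝ≥0∞)) ∧
    (∀ n, μ[fun ω => Z (n + 1) ω ^ 2 | present X n]
      =ᵐ[μ] fun ω => (εX (γ (n + 1)) : ℝ) * Vf (X n ω)) ∧
    Integrable Vf ν ∧
    (∀ᵐ ω ∂μ, Tendsto (fun n => ∫ x, Vf x ∂(empiricalMeasure (fun k => εX (γ k)) X n ω)) atTop
      (𝓝 (∫ x, Vf x ∂ν))) ∧
    LindebergCondition μ X (fun k => εX (γ k)) Z

/-- `∑_{n ≥ 1} εGC(γ_n) H_{εX,n}^{-ρ/2} g(X_{n-1}) < ∞` almost surely. -/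
def StepWeightCondition (μ : Measure Ω) (γ : ℕ → ℝ≥0) (X : ℕ → Ω → E) (g : E → ℝ≥0) (ρ : ℝ)
    (εX εGC : ℝ≥0 → ℝ≥0) : Prop :=
  ∀ᵐ ω ∂μ, Summable fun n : ℕ =>
    (εGC (γ (n + 1)) : ℝ) / (partialSum (fun k => εX (γ k)) (n + 1) : ℝ) ^ (ρ / 2) *
      (g (X n ω) : ℝ)

/-- The endpoint term `f(X_n)` is negligible with respect to `√H_{εX,n}`. There is no condition
when `f` is bounded (in particular when `f ∈ C₀(E)`); for unbounded `f`, negligibility is meant in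
probability, and almost surely when `Vf = 0`. -/
def NegligibleEndpoint (μ : Measure Ω) (γ : ℕ → ℝ≥0) (X : ℕ → Ω → E) (εX : ℝ≥0 → ℝ≥0)
    (f Vf : E → ℝ) : Prop :=
  (∃ K : ℝ, ∀ x, |f x| ≤ K) ∨
    (TendstoInMeasure μ
        (fun (n : ℕ) ω => f (X n ω) / √(partialSum (fun k => εX (γ k)) n : ℝ)) atTop
        (fun _ => 0) ∧
      (Vf = 0 → ∀ᵐ ω ∂μ, Tendsto
        (fun n : ℕ => f (X n ω) / √(partialSum (fun k => εX (γ k)) n : ℝ)) atTop (𝓝 0)))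

end Growth

end ErgodicCLT

namespace ErgodicCLT

/-! ### Weighted averages -/

/-! Write `H` for the partial sums of `εX (γ k)` and `H'` for those of `ηt (γ k)`. By
`sum_generator_eq`, the weighted sum of `A f` along the chain is exactly the sum of the centred
increments `D_k = -(f(X_{k+1}) - Q f(X_k))`, of the telescoped endpoint `f(X_n) - f(X_0)`, and of
the weak-error remainders with a minus sign. The remainders divided by `H'` converge almost surely
to `ν(M f)`, the increments divided by `√H` are asymptotically `N(0, ν(V f))`, and the endpoint is
negligible against `√H`. The three regimes only compare `√H` with `H'`, and Slutsky's theorem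
concludes.

The central limit theorem needs care. `D_k` is only integrable under the transition kernel, while
its square-integrable approximation `Z_{k+1}` is centred given `X_k` but need not be centred given
the whole past. So the `Z_{k+1}` are never summed: they serve to estimate the conditional
characteristic function of `D_k`. By the Markov property this function is the same given the past as
given `X_k`, hence it is an integral against the conditional law of `(Z_{k+1}, D_k)` given `X_k`
(`incrementKernel`). Under that law both coordinates are centred, and a Taylor expansion with
Lindeberg truncation compares the integral with a Gaussian factor (`norm_integral_exp_sub_le`).
`norm_integral_prod_sub_le` multiplies these estimates along the chain. The accumulated error tends
to its small limit in probability: the part of order `ρ` by the step-weight condition and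
Kronecker's lemma, the tail part by the Lindeberg condition, and the rest because it is a small
multiple of the normalised variance.

When `V f = 0`, the `Z_{k+1}` vanish almost surely. After localisation, `∑ D_k / √H_{k+1}` is an
`L¹`-bounded martingale (`ae_exists_tendsto_sum_of_bdd_moment`), so it converges, and Kronecker's
lemma gives the almost sure statement.

For the remainders, the error bound is averaged along a fixed trajectory inside the auxiliary
expectation. There the error density tends to zero with the step, and dominated convergence applies
(`tendsto_weighted_error`). -/

theorem tendsto_weighted_sum_div {p w a : ℕ → ℝ} {C : ℝ} (hp : ∀ k, 0 ≤ p k) (hw : ∀ k, 0 ≤ w k)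
    (hb : Tendsto (fun n => ∑ k ∈ Finset.range n, w k) atTop atTop)
    (hC : ∀ᶠ n in atTop, ∑ k ∈ Finset.range n, p k ≤ C * ∑ k ∈ Finset.range n, w k)
    (ha : Tendsto a atTop (𝓝 0)) :
    Tendsto (fun n => (∑ k ∈ Finset.range n, p k * a k) / ∑ k ∈ Finset.range n, w k) atTop
      (𝓝 0) := by
  -- The comparison is with `p + w` and not with `p`, whose sums need not diverge.
  have h1 : (fun k => p k * a k) =o[atTop] fun k => p k + w k := by
    rw [Asymptotics.isLittleO_iff]
    intro c hc
    filter_upwards [ha.eventually (Metric.ball_mem_nhds 0 hc)] with k hk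
    rw [dist_zero_right] at hk
    rw [norm_mul, Real.norm_of_nonneg (hp k), Real.norm_of_nonneg (add_nonneg (hp k) (hw k))]
    nlinarith [hp k, hw k, norm_nonneg (a k)]
  have h2 : Tendsto (fun n => ∑ k ∈ Finset.range n, (p k + w k)) atTop atTop :=
    tendsto_atTop_mono (fun n => Finset.sum_le_sum fun k _ => by linarith [hp k]) hb
  have h3 := h1.sum_range (fun k => add_nonneg (hp k) (hw k)) h2
  have h4 : (fun n => ∑ k ∈ Finset.range n, (p k + w k)) =O[atTop]
      fun n => ∑ k ∈ Finset.range n, w k := by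
    refine Asymptotics.IsBigO.of_bound (C + 1) ?_
    filter_upwards [hC] with n hn
    rw [Real.norm_of_nonneg (Finset.sum_nonneg fun k _ => add_nonneg (hp k) (hw k)),
      Real.norm_of_nonneg (Finset.sum_nonneg fun k _ => hw k), Finset.sum_add_distrib]
    linarith
  exact (h3.trans_isBigO h4).tendsto_div_nhds_zero

/-- **Kronecker's lemma**. -/
theorem tendsto_sum_div_of_tendsto_sum_div {b x : ℕ → ℝ} {c : ℝ} (hb0 : b 0 = 0)
    (hmono : Monotone b) (hb : Tendsto b atTop atTop)
    (hx : Tendsto (fun n => ∑ k ∈ Finset.range n, x k / b (k + 1)) atTop (𝓝 c)) :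
    Tendsto (fun n => (∑ k ∈ Finset.range n, x k) / b n) atTop (𝓝 0) := by
  set s : ℕ → ℝ := fun n => ∑ k ∈ Finset.range n, x k / b (k + 1) with hs
  have hbsum : ∀ n, ∑ k ∈ Finset.range n, (b (k + 1) - b k) = b n := fun n => by
    rw [Finset.sum_range_sub, hb0, sub_zero]
  have habel : ∀ n, ∑ k ∈ Finset.range n, b (k + 1) * (x k / b (k + 1)) =
      b n * (s n - c) - ∑ k ∈ Finset.range n, (b (k + 1) - b k) * (s k - c) := by
    intro n
    induction n with
    | zero => simp [hb0]
    | succ n ih =>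
      have : s (n + 1) = s n + x n / b (n + 1) := Finset.sum_range_succ _ _
      rw [Finset.sum_range_succ, Finset.sum_range_succ, ih, this]
      ring
  have h0 : Tendsto (fun n => s n - c) atTop (𝓝 0) := by
    simpa using hx.sub_const c
  have h1 : Tendsto (fun n => (∑ k ∈ Finset.range n, (b (k + 1) - b k) * (s k - c)) / b n) atTop
      (𝓝 0) := by
    have := tendsto_weighted_sum_div (p := fun k => b (k + 1) - b k)
      (w := fun k => b (k + 1) - b k) (C := 1) (fun k => sub_nonneg.2 (hmono k.le_succ))
      (fun k => sub_nonneg.2 (hmono k.le_succ)) (by simpa only [hbsum] using hb)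
      (Eventually.of_forall fun n => by rw [one_mul]) h0
    simpa only [hbsum] using this
  obtain ⟨N, hN⟩ := eventually_atTop.1 (hb.eventually_gt_atTop 0)
  -- Where `b (k + 1) = 0` the quotient is zero and `x k` is lost. This happens only for finitely
  -- many `k`, so the total loss is a constant `r`, negligible after division by `b n`.
  set r : ℝ := ∑ k ∈ Finset.range N, (x k - b (k + 1) * (x k / b (k + 1))) with hr
  have hsum : ∀ n, N ≤ n → ∑ k ∈ Finset.range n, (x k - b (k + 1) * (x k / b (k + 1))) = r := by
    intro n hn
    induction n, hn using Nat.le_induction with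
    | base => rfl
    | succ n hn ih =>
      have := (hN (n + 1) (by omega)).ne'
      rw [Finset.sum_range_succ, ih]
      field_simp
      ring
  have h2 : Tendsto (fun n => r / b n) atTop (𝓝 0) := hb.const_div_atTop r
  have h3 := (h2.add h0).sub h1
  simp only [add_zero, sub_zero] at h3
  refine h3.congr' ?_
  filter_upwards [eventually_ge_atTop N] with n hn
  have hne := (hN n hn).ne'
  have e1 := hsum n hn
  rw [Finset.sum_sub_distrib, habel] at e1
  field_simp
  linarith

/-! ### Elementary inequalities -/

/-- Taylor's formula gives order two near zero and the triangle inequality gives order one far away.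
As `1 ≤ ρ ≤ 2`, the power `|y| ^ ρ` dominates `y ^ 2` when `|y| ≤ 1` and `|y|` when `|y| ≥ 1`. -/
theorem norm_exp_mul_I_sub_le_rpow {ρ : ℝ} (hρ : ρ ∈ Set.Icc (1 : ℝ) 2) (y : ℝ) :
    ‖Complex.exp (y * Complex.I) - 1 - y * Complex.I‖ ≤ 3 * |y| ^ ρ := by
  have hn : ‖(y : ℂ) * Complex.I‖ = |y| := by simp
  rcases le_total |y| 1 with h | h
  · have h1 := Complex.norm_exp_sub_one_sub_id_le (x := y * Complex.I) (by rwa [hn])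
    rw [hn] at h1
    have h2 : |y| ^ (2 : ℝ) ≤ |y| ^ ρ := by
      rcases (abs_nonneg y).eq_or_lt with h0 | h0
      · rw [← h0, Real.zero_rpow two_ne_zero]
        exact Real.rpow_nonneg le_rfl _
      · exact Real.rpow_le_rpow_of_exponent_ge h0 h hρ.2
    rw [Real.rpow_two] at h2
    nlinarith [sq_nonneg |y|]
  · have h1 : |y| ≤ |y| ^ ρ := by
      simpa using Real.rpow_le_rpow_of_exponent_le h hρ.1
    calc ‖Complex.exp (y * Complex.I) - 1 - y * Complex.I‖
        ≤ ‖Complex.exp (y * Complex.I)‖ + ‖(1 : ℂ)‖ + ‖(y : ℂ) * Complex.I‖ :=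
          (norm_sub_le _ _).trans (by gcongr; exact norm_sub_le _ _)
      _ = 1 + 1 + |y| := by rw [Complex.norm_exp_ofReal_mul_I, norm_one, hn]
      _ ≤ _ := by linarith

theorem norm_exp_mul_I_sub_le_sq (y : ℝ) :
    ‖Complex.exp (y * Complex.I) - 1 - y * Complex.I + y ^ 2 / 2‖ ≤ 4 * y ^ 2 := by
  have h := norm_exp_mul_I_sub_le_rpow (ρ := 2) (by norm_num) y
  rw [Real.rpow_two, sq_abs] at h
  refine (norm_add_le _ _).trans ?_
  have : ‖(y : ℂ) ^ 2 / 2‖ = y ^ 2 / 2 := by simp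
  rw [this]
  nlinarith [sq_nonneg y]

/-- This form serves below the Lindeberg truncation level, where the extra factor `|y|` is small.
The quadratic form above serves beyond that level. -/
theorem norm_exp_mul_I_sub_le_cube (y : ℝ) :
    ‖Complex.exp (y * Complex.I) - 1 - y * Complex.I + y ^ 2 / 2‖ ≤ 4 * |y| * y ^ 2 := by
  rcases le_total |y| 1 with h | h
  · have hn : ‖(y : ℂ) * Complex.I‖ = |y| := by simp
    have h1 := Complex.exp_bound (x := y * Complex.I) (by rwa [hn]) (n := 3) (by norm_num)
    have e : ∑ m ∈ Finset.range 3, ((y : ℂ) * Complex.I) ^ m / (m.factorial : ℂ) =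
        1 + y * Complex.I - y ^ 2 / 2 := by
      simp [Finset.sum_range_succ, mul_pow, Nat.factorial]
      ring
    rw [e, hn] at h1
    have e2 : Complex.exp (y * Complex.I) - 1 - y * Complex.I + y ^ 2 / 2 =
        Complex.exp (y * Complex.I) - (1 + y * Complex.I - y ^ 2 / 2) := by ring
    rw [e2]
    refine h1.trans ?_
    have : |y| ^ 3 = |y| * y ^ 2 := by rw [pow_succ', sq_abs]
    rw [this]
    norm_num [Nat.factorial]
    nlinarith [mul_nonneg (abs_nonneg y) (sq_nonneg y)]
  · refine (norm_exp_mul_I_sub_le_sq y).trans ?_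
    nlinarith [sq_nonneg y]

/-- A Young-type inequality for the cross term between the approximation error `t` and the main
variable `y`. If `|t| ≤ δ |y|`, the square of `y` absorbs everything. Otherwise `|y| ≤ |t| / δ`, and
what remains is at most `|t| ^ 2 / δ` or `2 |t|`, according to the size of `|t|`. -/
theorem mul_norm_exp_mul_I_sub_one_le {ρ δ : ℝ} (hρ : ρ ∈ Set.Icc (1 : ℝ) 2) (hδ : 0 < δ)
    (hδ1 : δ ≤ 1) (t y : ℝ) :
    |t| * ‖Complex.exp (y * Complex.I) - 1‖ ≤ δ * y ^ 2 + 2 / δ * |t| ^ ρ := by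
  have h1 : ‖Complex.exp (y * Complex.I) - 1‖ ≤ |y| := by
    have := Real.norm_exp_I_mul_ofReal_sub_one_le (x := y)
    rwa [mul_comm] at this
  have h2 : ‖Complex.exp (y * Complex.I) - 1‖ ≤ 2 := by
    refine (norm_sub_le _ _).trans ?_
    rw [Complex.norm_exp_ofReal_mul_I, norm_one]
    norm_num
  have hr : 0 ≤ |t| ^ ρ := Real.rpow_nonneg (abs_nonneg t) ρ
  have hq : 0 ≤ 2 / δ * |t| ^ ρ := by positivity
  rcases le_total |t| (δ * |y|) with h | h
  · calc |t| * ‖Complex.exp (y * Complex.I) - 1‖ ≤ (δ * |y|) * |y| := by gcongr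
      _ = δ * y ^ 2 := by rw [mul_assoc, ← sq, sq_abs]
      _ ≤ _ := by linarith
  · have h3 : |y| ≤ |t| / δ := by rw [le_div_iff₀ hδ]; linarith
    have key : |t| * ‖Complex.exp (y * Complex.I) - 1‖ ≤ 2 / δ * |t| ^ ρ := by
      rcases le_total |t| 1 with ht | ht
      · have h4 : |t| ^ 2 ≤ |t| ^ ρ := by
          rcases (abs_nonneg t).eq_or_lt with h0 | h0
          · rw [← h0]; simpa using Real.rpow_nonneg le_rfl ρ
          · rw [← Real.rpow_two]
            exact Real.rpow_le_rpow_of_exponent_ge h0 ht hρ.2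
        calc |t| * ‖Complex.exp (y * Complex.I) - 1‖ ≤ |t| * (|t| / δ) := by
              gcongr; exact h1.trans h3
          _ = 1 / δ * |t| ^ 2 := by ring
          _ ≤ 2 / δ * |t| ^ ρ := by gcongr; norm_num
      · have h4 : |t| ≤ |t| ^ ρ := by
          simpa using Real.rpow_le_rpow_of_exponent_le ht hρ.1
        have h5 : 2 ≤ 2 / δ := by rw [le_div_iff₀ hδ]; linarith
        calc |t| * ‖Complex.exp (y * Complex.I) - 1‖ ≤ |t| ^ ρ * 2 := by gcongr
          _ ≤ 2 / δ * |t| ^ ρ := by rw [mul_comm]; gcongr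
    nlinarith [sq_nonneg y]

/-- The exponent is split into a part `p` that will be small, for which a quadratic error is
affordable, and a tail part `q`, for which only a linear error is available. -/
theorem abs_exp_neg_sub_le {p q : ℝ} (hp : 0 ≤ p) (hq : 0 ≤ q) :
    |Real.exp (-(p + q)) - (1 - (p + q))| ≤ p ^ 2 + q := by
  have h1 : 1 - (p + q) ≤ Real.exp (-(p + q)) := by
    linarith [Real.add_one_le_exp (-(p + q))]
  rw [abs_of_nonneg (by linarith)]
  have h2 : Real.exp (-(p + q)) ≤ Real.exp (-p) := Real.exp_le_exp.2 (by linarith)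
  have h3 : Real.exp (-p) ≤ 1 - p + p ^ 2 := by
    rcases le_total p 1 with h | h
    · have := Real.norm_exp_sub_one_sub_id_le (x := -p) (by
        rwa [norm_neg, Real.norm_of_nonneg hp])
      rw [Real.norm_eq_abs, Real.norm_eq_abs, sq_abs] at this
      nlinarith [(abs_le.1 this).2]
    · have : Real.exp (-p) ≤ 1 := Real.exp_le_one_iff.2 (by linarith)
      nlinarith
  linarith

/-- The function `√(1 + x ^ 2)` is a smooth substitute for `|x|` with bounded first and second
derivatives. Its Taylor remainder is therefore of order two for small `y` and of order one for large
`y`, hence of order `ρ`. Along a martingale the linear term has mean zero. -/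
theorem sqrt_one_add_sq_add_le {ρ : ℝ} (hρ : ρ ∈ Set.Icc (1 : ℝ) 2) (x y : ℝ) :
    √(1 + (x + y) ^ 2) ≤ √(1 + x ^ 2) + x / √(1 + x ^ 2) * y + 2 * |y| ^ ρ := by
  set A := √(1 + x ^ 2) with hA
  have hA2 : A ^ 2 = 1 + x ^ 2 := Real.sq_sqrt (by positivity)
  have hA1 : 1 ≤ A := Real.one_le_sqrt.2 (by nlinarith [sq_nonneg x])
  have hA0 : 0 < A := by linarith
  rcases le_total |y| 1 with h | h
  · have h2 : y ^ 2 ≤ |y| ^ ρ := by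
      rcases (abs_nonneg y).eq_or_lt with h0 | h0
      · rw [← sq_abs, ← h0]; simpa using Real.rpow_nonneg le_rfl ρ
      · rw [← sq_abs, ← Real.rpow_two]
        exact Real.rpow_le_rpow_of_exponent_ge h0 h hρ.2
    have h3 : √(1 + (x + y) ^ 2) ≤ A + (x * y + y ^ 2 / 2) / A := by
      have e : A + (x * y + y ^ 2 / 2) / A = (1 + x ^ 2 + x * y + y ^ 2 / 2) / A := by
        field_simp; rw [hA2]; ring
      refine Real.sqrt_le_iff.2 ⟨?_, ?_⟩
      · rw [e]
        exact div_nonneg (by nlinarith [sq_nonneg (x + y), sq_nonneg x]) hA0.le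
      · have e2 : (A + (x * y + y ^ 2 / 2) / A) ^ 2 =
            A ^ 2 + (2 * x * y + y ^ 2) + ((x * y + y ^ 2 / 2) / A) ^ 2 := by
          field_simp; ring
        rw [e2, hA2]
        nlinarith [sq_nonneg ((x * y + y ^ 2 / 2) / A)]
    have h4 : (x * y + y ^ 2 / 2) / A ≤ x / A * y + y ^ 2 := by
      have : (x * y + y ^ 2 / 2) / A = x / A * y + (y ^ 2 / 2) / A := by ring
      rw [this]
      have : (y ^ 2 / 2) / A ≤ y ^ 2 := by
        rw [div_le_iff₀ hA0]; nlinarith [sq_nonneg y]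
      linarith
    nlinarith [sq_nonneg y]
  · have h2 : |y| ≤ |y| ^ ρ := by
      simpa using Real.rpow_le_rpow_of_exponent_le h hρ.1
    have hxA : |x| ≤ A := Real.abs_le_sqrt (by linarith)
    have h3 : √(1 + (x + y) ^ 2) ≤ A + |y| := by
      refine Real.sqrt_le_iff.2 ⟨by positivity, ?_⟩
      have : (A + |y|) ^ 2 = 1 + x ^ 2 + 2 * A * |y| + y ^ 2 := by
        rw [add_sq, hA2, sq_abs]
      rw [this]
      have h5 : x * y ≤ A * |y| := by
        calc x * y ≤ |x * y| := le_abs_self _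
          _ = |x| * |y| := abs_mul _ _
          _ ≤ A * |y| := by gcongr
      nlinarith
    have h4 : -|y| ≤ x / A * y := by
      have : |x / A * y| ≤ |y| := by
        rw [abs_mul, abs_div, abs_of_pos hA0]
        exact mul_le_of_le_one_left (abs_nonneg y) ((div_le_one hA0).2 hxA)
      exact (abs_le.1 this).1
    linarith

/-! ### Characteristic function of a perturbed centred variable -/

/-- With `d = z + r`, the left side is the sum of `exp(iaz) (exp(iar) - 1 - iar)`, of the cross term
`iar (exp(iaz) - 1)`, and of the Taylor remainder of `exp(iaz)`. The linear terms in `z` and `r` are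
subtracted because they integrate to zero when `z` and `d` are centred. Thus no second moment of `r`
is needed. -/
theorem norm_exp_perturbation_le {ρ δ e : ℝ} (hρ : ρ ∈ Set.Icc (1 : ℝ) 2) (hδ : 0 < δ)
    (hδ1 : δ ≤ 1) (he : 0 ≤ e) (a z d : ℝ) :
    ‖Complex.exp ((a * d : ℝ) * Complex.I) - 1 - (a * z : ℝ) * Complex.I + (a * z : ℝ) ^ 2 / 2
        - (a * (d - z) : ℝ) * Complex.I‖
      ≤ (3 + 2 / δ) * (|a| ^ ρ * |d - z| ^ ρ) + (δ * a ^ 2 + 4 * (|a| * e) * a ^ 2) * z ^ 2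
        + 4 * a ^ 2 * {x : ℝ | e < |x|}.indicator (fun x => x ^ 2) z := by
  set r := d - z with hr
  have hd : d = z + r := by rw [hr]; ring
  have e1 : Complex.exp ((a * d : ℝ) * Complex.I) - 1 - (a * z : ℝ) * Complex.I
        + (a * z : ℝ) ^ 2 / 2 - (a * r : ℝ) * Complex.I =
      Complex.exp ((a * z : ℝ) * Complex.I) *
          (Complex.exp ((a * r : ℝ) * Complex.I) - 1 - (a * r : ℝ) * Complex.I)
        + (a * r : ℝ) * Complex.I * (Complex.exp ((a * z : ℝ) * Complex.I) - 1)
        + (Complex.exp ((a * z : ℝ) * Complex.I) - 1 - (a * z : ℝ) * Complex.I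
          + (a * z : ℝ) ^ 2 / 2) := by
    have : Complex.exp ((a * d : ℝ) * Complex.I) =
        Complex.exp ((a * z : ℝ) * Complex.I) * Complex.exp ((a * r : ℝ) * Complex.I) := by
      rw [← Complex.exp_add, hd]; congr 1; push_cast; ring
    rw [this]; ring
  rw [e1]
  have hpow : |a * r| ^ ρ = |a| ^ ρ * |r| ^ ρ := by
    rw [abs_mul, Real.mul_rpow (abs_nonneg _) (abs_nonneg _)]
  have b1 := norm_exp_mul_I_sub_le_rpow hρ (a * r)
  have b2 := mul_norm_exp_mul_I_sub_one_le hρ hδ hδ1 (a * r) (a * z)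
  rw [hpow] at b1 b2
  have b3 : ‖Complex.exp ((a * z : ℝ) * Complex.I) - 1 - (a * z : ℝ) * Complex.I
      + (a * z : ℝ) ^ 2 / 2‖ ≤ 4 * (|a| * e) * a ^ 2 * z ^ 2
        + 4 * a ^ 2 * {x : ℝ | e < |x|}.indicator (fun x => x ^ 2) z := by
    by_cases h : e < |z|
    · rw [Set.indicator_of_mem (by exact h)]
      refine (norm_exp_mul_I_sub_le_sq (a * z)).trans ?_
      have : 0 ≤ 4 * (|a| * e) * a ^ 2 * z ^ 2 := by positivity
      nlinarith
    · rw [Set.indicator_of_notMem (by exact h)]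
      refine (norm_exp_mul_I_sub_le_cube (a * z)).trans ?_
      rw [abs_mul]
      have : |a| * |z| ≤ |a| * e := by gcongr; exact not_lt.1 h
      have h2 : 0 ≤ (a * z) ^ 2 := sq_nonneg _
      nlinarith
  refine (norm_add₃_le).trans ?_
  rw [norm_mul, norm_mul, norm_mul, Complex.norm_exp_ofReal_mul_I, Complex.norm_I,
    Complex.norm_real, Real.norm_eq_abs, one_mul, mul_one]
  calc _ ≤ 3 * (|a| ^ ρ * |r| ^ ρ) + (δ * (a * z) ^ 2 + 2 / δ * (|a| ^ ρ * |r| ^ ρ)) +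
        (4 * (|a| * e) * a ^ 2 * z ^ 2
          + 4 * a ^ 2 * {x : ℝ | e < |x|}.indicator (fun x => x ^ 2) z) :=
        add_le_add (add_le_add b1 b2) b3
    _ = _ := by ring

/-- Both the integral and the Gaussian factor are compared with `1 - a ^ 2 s / 2`, where `s` is the
second moment of `z`. The variable `d` enters only through its centring and the `ρ`-moment of `d -
z`. -/
theorem norm_integral_exp_sub_le {S : Type*} [MeasurableSpace S] {κ : Measure S}
    [IsProbabilityMeasure κ] {z d : S → ℝ} (hz : Measurable z) (hz2 : Integrable (fun ω => z ω ^ 2) κ)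
    (hz0 : ∫ ω, z ω ∂κ = 0) (hd : Measurable d) (hdi : Integrable d κ) (hd0 : ∫ ω, d ω ∂κ = 0)
    {ρ δ e m : ℝ} (hρ : ρ ∈ Set.Icc (1 : ℝ) 2) (hδ : 0 < δ) (hδ1 : δ ≤ 1) (he : 0 ≤ e)
    (hr : Integrable (fun ω => |d ω - z ω| ^ ρ) κ) (hm : ∫ ω, |d ω - z ω| ^ ρ ∂κ ≤ m) (a : ℝ) :
    ‖∫ ω, Complex.exp ((a * d ω : ℝ) * Complex.I) ∂κ
        - Real.exp (-(a ^ 2 * (∫ ω, z ω ^ 2 ∂κ) / 2))‖ ≤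
      (3 + 2 / δ) * (|a| ^ ρ * m)
        + (δ * a ^ 2 + 4 * (|a| * e) * a ^ 2 + a ^ 4 * e ^ 2) * (∫ ω, z ω ^ 2 ∂κ)
        + 5 * a ^ 2 * ∫ ω, {x : ℝ | e < |x|}.indicator (fun x => x ^ 2) (z ω) ∂κ := by
  set s := ∫ ω, z ω ^ 2 ∂κ with hs
  set L := ∫ ω, {x : ℝ | e < |x|}.indicator (fun x => x ^ 2) (z ω) ∂κ with hL
  have hset : MeasurableSet {x : ℝ | e < |x|} := measurableSet_lt (by fun_prop) (by fun_prop)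
  have hLi : Integrable (fun ω => {x : ℝ | e < |x|}.indicator (fun x => x ^ 2) (z ω)) κ := by
    refine hz2.indicator (hz hset) |>.congr (ae_of_all _ fun ω => ?_)
    simp [Set.indicator]
  have hzi : Integrable z κ := by
    have : MemLp z 2 κ := (memLp_two_iff_integrable_sq hz.aestronglyMeasurable).2 hz2
    exact this.integrable one_le_two
  have hexp : Integrable (fun ω => Complex.exp ((a * d ω : ℝ) * Complex.I)) κ :=
    Integrable.of_bound (by fun_prop) 1 (ae_of_all _ fun ω => by
      rw [Complex.norm_exp_ofReal_mul_I])
  have hi1 : Integrable (fun ω => ((a * z ω : ℝ) : ℂ) * Complex.I) κ :=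
    (hzi.const_mul a).ofReal.mul_const _
  have hi2 : Integrable (fun ω => ((a * z ω : ℝ) : ℂ) ^ 2 / 2) κ := by
    have : Integrable (fun ω => ((a ^ 2 * z ω ^ 2 / 2 : ℝ) : ℂ)) κ :=
      ((hz2.const_mul (a ^ 2)).div_const 2).ofReal
    refine this.congr (ae_of_all _ fun ω => ?_)
    push_cast; ring
  have hi3 : Integrable (fun ω => ((a * (d ω - z ω) : ℝ) : ℂ) * Complex.I) κ :=
    ((hdi.sub hzi).const_mul a).ofReal.mul_const _
  have e1 : ∫ ω, ((a * z ω : ℝ) : ℂ) * Complex.I ∂κ = 0 := by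
    rw [integral_mul_const, integral_complex_ofReal, integral_const_mul, hz0]; simp
  have e2 : ∫ ω, ((a * z ω : ℝ) : ℂ) ^ 2 / 2 ∂κ = ((a ^ 2 * s / 2 : ℝ) : ℂ) := by
    rw [hs, ← integral_const_mul, ← integral_div, ← integral_complex_ofReal]
    refine integral_congr_ae (ae_of_all _ fun ω => ?_)
    push_cast; ring
  have e3 : ∫ ω, ((a * (d ω - z ω) : ℝ) : ℂ) * Complex.I ∂κ = 0 := by
    rw [integral_mul_const, integral_complex_ofReal, integral_const_mul,
      integral_sub hdi hzi, hz0, hd0]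
    simp
  have main : ‖∫ ω, Complex.exp ((a * d ω : ℝ) * Complex.I) ∂κ - 1 + (a ^ 2 * s / 2 : ℝ)‖ ≤
      (3 + 2 / δ) * (|a| ^ ρ * m) + (δ * a ^ 2 + 4 * (|a| * e) * a ^ 2) * s + 4 * a ^ 2 * L := by
    have e4 : ∫ ω, Complex.exp ((a * d ω : ℝ) * Complex.I) ∂κ - 1 + (a ^ 2 * s / 2 : ℝ) =
        ∫ ω, (Complex.exp ((a * d ω : ℝ) * Complex.I) - 1 - (a * z ω : ℝ) * Complex.I
          + (a * z ω : ℝ) ^ 2 / 2 - (a * (d ω - z ω) : ℝ) * Complex.I) ∂κ := by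
      have j1 : Integrable (fun ω => Complex.exp ((a * d ω : ℝ) * Complex.I) - 1) κ :=
        hexp.sub (integrable_const 1)
      have j2 : Integrable (fun ω => Complex.exp ((a * d ω : ℝ) * Complex.I) - 1
        - (a * z ω : ℝ) * Complex.I) κ := j1.sub hi1
      have j3 : Integrable (fun ω => Complex.exp ((a * d ω : ℝ) * Complex.I) - 1
        - (a * z ω : ℝ) * Complex.I + (a * z ω : ℝ) ^ 2 / 2) κ := j2.add hi2
      rw [integral_sub j3 hi3, integral_add j2 hi2, integral_sub j1 hi1,
        integral_sub hexp (integrable_const 1), e1, e2, e3]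
      simp
    have k1 : Integrable (fun ω => (3 + 2 / δ) * (|a| ^ ρ * |d ω - z ω| ^ ρ)
        + (δ * a ^ 2 + 4 * (|a| * e) * a ^ 2) * z ω ^ 2) κ :=
      ((hr.const_mul _).const_mul _).add (hz2.const_mul _)
    rw [e4]
    refine (norm_integral_le_of_norm_le (g := fun ω => (3 + 2 / δ) * (|a| ^ ρ * |d ω - z ω| ^ ρ)
      + (δ * a ^ 2 + 4 * (|a| * e) * a ^ 2) * z ω ^ 2
      + 4 * a ^ 2 * {x : ℝ | e < |x|}.indicator (fun x => x ^ 2) (z ω)) ?_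
      (ae_of_all _ fun ω => norm_exp_perturbation_le hρ hδ hδ1 he a (z ω) (d ω))).trans ?_
    · exact k1.add (hLi.const_mul _)
    · rw [integral_add k1 (hLi.const_mul _),
        integral_add ((hr.const_mul _).const_mul _) (hz2.const_mul _), integral_const_mul,
        integral_const_mul, integral_const_mul, integral_const_mul]
      have : 0 ≤ |a| ^ ρ := Real.rpow_nonneg (abs_nonneg a) ρ
      gcongr
  have hL0 : 0 ≤ L := integral_nonneg fun ω => Set.indicator_nonneg (fun x _ => sq_nonneg x) _
  -- `s - L` is the second moment of `z` restricted to `|z| ≤ e`. Its bound by `e ^ 2` makes its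
  -- square at most `e ^ 2 * s`, which stays summable along the chain.
  have hs1 : 0 ≤ s - L ∧ s - L ≤ e ^ 2 := by
    rw [hs, hL, ← integral_sub hz2 hLi]
    have hb : ∀ ω, 0 ≤ z ω ^ 2 - {x : ℝ | e < |x|}.indicator (fun x => x ^ 2) (z ω) ∧
        z ω ^ 2 - {x : ℝ | e < |x|}.indicator (fun x => x ^ 2) (z ω) ≤ e ^ 2 := by
      intro ω
      by_cases h : e < |z ω|
      · rw [Set.indicator_of_mem (by exact h)]
        simp [sq_nonneg]
      · rw [Set.indicator_of_notMem (by exact h), sub_zero]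
        refine ⟨sq_nonneg _, ?_⟩
        rw [← sq_abs]
        exact pow_le_pow_left₀ (abs_nonneg _) (not_lt.1 h) 2
    refine ⟨integral_nonneg fun ω => (hb ω).1, ?_⟩
    calc _ ≤ ∫ _, e ^ 2 ∂κ := integral_mono (hz2.sub hLi) (integrable_const _) fun ω => (hb ω).2
      _ = e ^ 2 := by simp
  have second : ‖((Real.exp (-(a ^ 2 * s / 2)) : ℝ) : ℂ) - (1 - (a ^ 2 * s / 2 : ℝ))‖ ≤
      a ^ 4 * e ^ 2 * s + a ^ 2 * L := by
    have h := abs_exp_neg_sub_le (p := a ^ 2 * (s - L) / 2) (q := a ^ 2 * L / 2)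
      (by have := hs1.1; positivity) (by positivity)
    have e5 : a ^ 2 * (s - L) / 2 + a ^ 2 * L / 2 = a ^ 2 * s / 2 := by ring
    rw [e5] at h
    rw [← Complex.ofReal_one, ← Complex.ofReal_sub, ← Complex.ofReal_sub, Complex.norm_real,
      Real.norm_eq_abs]
    refine h.trans ?_
    have h6 : (s - L) ^ 2 ≤ e ^ 2 * s := by
      rw [sq]
      exact mul_le_mul hs1.2 (by linarith) hs1.1 (sq_nonneg e)
    have h7 : a ^ 4 * (s - L) ^ 2 ≤ a ^ 4 * (e ^ 2 * s) := by gcongr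
    have h8 : 0 ≤ a ^ 2 * L := by positivity
    have h9 : 0 ≤ a ^ 4 * (s - L) ^ 2 := by positivity
    nlinarith
  have e6 : ∫ ω, Complex.exp ((a * d ω : ℝ) * Complex.I) ∂κ - Real.exp (-(a ^ 2 * s / 2)) =
      (∫ ω, Complex.exp ((a * d ω : ℝ) * Complex.I) ∂κ - 1 + (a ^ 2 * s / 2 : ℝ)) -
      (((Real.exp (-(a ^ 2 * s / 2)) : ℝ) : ℂ) - (1 - (a ^ 2 * s / 2 : ℝ))) := by ring
  rw [e6]
  refine (norm_sub_le _ _).trans ((add_le_add main second).trans (le_of_eq ?_))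
  ring

/-! ### Stopping a sum before it exceeds a level -/

/-- The terms kept up to the last index satisfying `p` are part of the full sum up to that index.
Since the test at `k` includes the term `c k`, there is no overshoot. -/
theorem sum_ite_le_of_forall_imp {c : ℕ → ℝ} {p : ℕ → Prop} [DecidablePred p] {C : ℝ} (hc : ∀ k, 0 ≤ c k)
    (hC : 0 ≤ C) (hp : ∀ k, p k → ∑ j ∈ Finset.range (k + 1), c j ≤ C) (n : ℕ) :
    ∑ k ∈ Finset.range n, (if p k then c k else 0) ≤ C := by
  induction n with
  | zero => simpa
  | succ n ih =>
    by_cases h : p n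
    · refine (Finset.sum_le_sum fun k _ => ?_).trans (hp n h)
      split_ifs
      · exact le_rfl
      · exact hc k
    · rw [Finset.sum_range_succ, if_neg h, add_zero]
      exact ih

/-! ### Products of conditionally nearly Gaussian factors -/

section Product

variable {Ω : Type*} {mΩ : MeasurableSpace Ω} {μ : Measure Ω} [IsProbabilityMeasure μ]

theorem integral_mul_condExp_eq {m : MeasurableSpace Ω} (hm : m ≤ mΩ) {W ζ : Ω → ℂ} {K : ℝ}
    (hW : StronglyMeasurable[m] W) (hK : ∀ ω, ‖W ω‖ ≤ K) (hζ : Integrable ζ μ) :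
    ∫ ω, W ω * ζ ω ∂μ = ∫ ω, W ω * (μ[ζ | m]) ω ∂μ := by
  have h := condExp_bilin_of_stronglyMeasurable_left (μ := μ) (.mul ℝ ℂ) hW
    (hζ.bdd_mul (hW.mono hm).aestronglyMeasurable (ae_of_all _ hK)) hζ
  rw [← integral_condExp hm]
  exact integral_congr_ae h

open Classical in
-- Multiplying each factor by `exp (x k)` turns the product into an almost-martingale with mean
-- close to one. A predictable cut-off keeps it bounded by `exp (σ + 1)`. Outside the exceptional
-- event the cut-off is inactive and `∑ x` is within `θ` of `σ`, so the original product is close to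
-- `exp (-σ)` times the modified one. Of the two `exp (σ + 1) * θ`, one comes from the drift of the
-- almost-martingale and one from replacing `∑ x` by `σ`.
theorem norm_integral_prod_sub_le (ℱ : Filtration ℕ mΩ) {ζ : ℕ → Ω → ℂ} {x δ : ℕ → Ω → ℝ}
    (hζ : ∀ k, StronglyMeasurable[ℱ (k + 1)] (ζ k)) (hζ1 : ∀ k ω, ‖ζ k ω‖ ≤ 1)
    (hx : ∀ k, Measurable[ℱ k] (x k)) (hx0 : ∀ k ω, 0 ≤ x k ω)
    (hδ : ∀ k, Measurable[ℱ k] (δ k)) (hδ0 : ∀ k ω, 0 ≤ δ k ω)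
    (hcond : ∀ k, ∀ᵐ ω ∂μ, ‖(μ[ζ k | ℱ k]) ω - Real.exp (-x k ω)‖ ≤ δ k ω)
    {σ θ : ℝ} (hσ : 0 ≤ σ) (hθ : 0 < θ) (hθ1 : θ ≤ 1) (n : ℕ) :
    ‖∫ ω, ∏ k ∈ Finset.range n, ζ k ω ∂μ - Real.exp (-σ)‖ ≤
      2 * Real.exp (σ + 1) * θ + (1 + Real.exp (σ + 1)) *
        μ.real {ω | θ < |∑ k ∈ Finset.range n, x k ω - σ| ∨
          θ < ∑ k ∈ Finset.range n, δ k ω} := by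
  set B : ℝ := σ + 1 with hB
  -- Both sums run up to and including `k` and are still known at time `k`, because `x` and `δ` are
  -- predictable. The margin `B = σ + 1` suffices because `θ ≤ 1`.
  let p : ℕ → Ω → Prop := fun k ω =>
    ∑ j ∈ Finset.range (k + 1), x j ω ≤ B ∧ ∑ j ∈ Finset.range (k + 1), δ j ω ≤ θ
  have hsum : ∀ {c : ℕ → Ω → ℝ} (_ : ∀ k, Measurable[ℱ k] (c k)) (k : ℕ),
      Measurable[ℱ k] (fun ω => ∑ j ∈ Finset.range (k + 1), c j ω) := fun hc k =>
    Finset.measurable_fun_sum _ fun j hj =>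
      (hc j).mono (ℱ.mono (Finset.mem_range_succ_iff.1 hj)) le_rfl
  have hp : ∀ k, MeasurableSet[ℱ k] {ω | p k ω} := fun k =>
    (@measurableSet_le _ _ _ _ _ (ℱ k) _ _ _ _ _ (hsum hx k) measurable_const).inter
      (@measurableSet_le _ _ _ _ _ (ℱ k) _ _ _ _ _ (hsum hδ k) measurable_const)
  let F : ℕ → Ω → ℂ := fun k ω => if p k ω then ζ k ω * Real.exp (x k ω) else 1
  let Z : ℕ → Ω → ℂ := fun k ω => ∏ j ∈ Finset.range k, F j ω
  have hF : ∀ k, StronglyMeasurable[ℱ (k + 1)] (F k) := fun k => by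
    have h1 : Measurable[ℱ (k + 1)] fun ω => ((Real.exp (x k ω) : ℝ) : ℂ) :=
      Complex.measurable_ofReal.comp
        (Real.measurable_exp.comp ((hx k).mono (ℱ.mono k.le_succ) le_rfl))
    exact StronglyMeasurable.ite (ℱ.mono k.le_succ _ (hp k))
      ((hζ k).mul h1.stronglyMeasurable) stronglyMeasurable_const
  have hZ : ∀ k, StronglyMeasurable[ℱ k] (Z k) := fun k =>
    Finset.stronglyMeasurable_fun_prod _ fun j hj =>
      (hF j).mono (ℱ.mono (Finset.mem_range.1 hj))
  have hFn : ∀ k ω, ‖F k ω‖ ≤ Real.exp (if p k ω then x k ω else 0) := fun k ω => by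
    simp only [F]
    split_ifs
    · rw [norm_mul, Complex.norm_real, Real.norm_of_nonneg (Real.exp_pos _).le]
      exact mul_le_of_le_one_left (Real.exp_pos _).le (hζ1 k ω)
    · simp
  have hZn' : ∀ k ω, ‖Z k ω‖ ≤ Real.exp (∑ j ∈ Finset.range k, if p j ω then x j ω else 0) :=
    fun k ω => by
      rw [norm_prod, Real.exp_sum]
      exact Finset.prod_le_prod (fun _ _ => norm_nonneg _) fun j _ => hFn j ω
  have hxB : ∀ k ω, (∑ j ∈ Finset.range k, if p j ω then x j ω else 0) ≤ B := fun k ω =>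
    sum_ite_le_of_forall_imp (fun j => hx0 j ω) (by linarith)
      (fun j (hj : p j ω) => hj.1) k
  have hZn : ∀ k ω, ‖Z k ω‖ ≤ Real.exp B := fun k ω =>
    (hZn' k ω).trans (Real.exp_le_exp.2 (hxB k ω))
  have hZi : ∀ k, Integrable (Z k) μ := fun k =>
    Integrable.of_bound ((hZ k).mono (ℱ.le k)).aestronglyMeasurable _ (ae_of_all _ (hZn k))
  have hζi : ∀ k, Integrable (ζ k) μ := fun k =>
    Integrable.of_bound ((hζ k).mono (ℱ.le (k + 1))).aestronglyMeasurable _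
      (ae_of_all _ (hζ1 k))
  have hδi : ∀ k, Integrable (fun ω => if p k ω then δ k ω else 0) μ := fun k => by
    refine Integrable.of_bound (C := θ) ?_ (ae_of_all _ fun ω => ?_)
    · exact (Measurable.ite (ℱ.le k _ (hp k)) ((hδ k).mono (ℱ.le k) le_rfl)
        measurable_const).aestronglyMeasurable
    · split_ifs with h
      · rw [Real.norm_of_nonneg (hδ0 k ω)]
        exact (Finset.single_le_sum (f := fun j => δ j ω) (fun j _ => hδ0 j ω)
          (Finset.self_mem_range_succ k)).trans h.2
      · simpa using hθ.le
  have hstep : ∀ k, ‖∫ ω, Z (k + 1) ω ∂μ - ∫ ω, Z k ω ∂μ‖ ≤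
      Real.exp B * ∫ ω, (if p k ω then δ k ω else 0) ∂μ := by
    intro k
    -- `Z (k + 1) - Z k = W (ζ k - exp (-x k))` with `W` known at time `k`, so `ζ k` may be replaced
    -- by its conditional expectation.
    let W : Ω → ℂ := fun ω => if p k ω then Z k ω * Real.exp (x k ω) else 0
    have hW : StronglyMeasurable[ℱ k] W := by
      have h1 : Measurable[ℱ k] fun ω => ((Real.exp (x k ω) : ℝ) : ℂ) :=
        Complex.measurable_ofReal.comp (Real.measurable_exp.comp (hx k))
      exact StronglyMeasurable.ite (hp k) ((hZ k).mul h1.stronglyMeasurable)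
        stronglyMeasurable_const
    have hWn : ∀ ω, ‖W ω‖ ≤ Real.exp B := fun ω => by
      simp only [W]
      split_ifs with h
      · rw [norm_mul, Complex.norm_real, Real.norm_of_nonneg (Real.exp_pos _).le]
        have h1 := hxB (k + 1) ω
        rw [Finset.sum_range_succ, if_pos h] at h1
        calc _ ≤ Real.exp (∑ j ∈ Finset.range k, if p j ω then x j ω else 0) * Real.exp (x k ω) :=
              mul_le_mul_of_nonneg_right (hZn' k ω) (Real.exp_pos _).le
          _ ≤ Real.exp B := by rw [← Real.exp_add]; exact Real.exp_le_exp.2 h1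
      · simpa using (Real.exp_pos B).le
    have hexpm : StronglyMeasurable fun ω => ((Real.exp (-x k ω) : ℝ) : ℂ) := by
      have := (hx k).mono (ℱ.le k) le_rfl
      exact (by fun_prop : Measurable _).stronglyMeasurable
    have hexpi : Integrable (fun ω => ((Real.exp (-x k ω) : ℝ) : ℂ)) μ :=
      Integrable.of_bound hexpm.aestronglyMeasurable 1 (ae_of_all _ fun ω => by
        rw [Complex.norm_real, Real.norm_of_nonneg (Real.exp_pos _).le]
        exact Real.exp_le_one_iff.2 (by linarith [hx0 k ω]))
    have hWm := (hW.mono (ℱ.le k)).aestronglyMeasurable (μ := μ)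
    have e1 : ∫ ω, Z (k + 1) ω ∂μ - ∫ ω, Z k ω ∂μ =
        ∫ ω, W ω * ((μ[ζ k | ℱ k]) ω - Real.exp (-x k ω)) ∂μ := by
      rw [← integral_sub (hZi _) (hZi _)]
      have e2 : ∀ ω, Z (k + 1) ω - Z k ω = W ω * ζ k ω - W ω * Real.exp (-x k ω) := fun ω => by
        have : Z (k + 1) ω = Z k ω * F k ω := Finset.prod_range_succ _ _
        rw [this]
        simp only [F, W]
        split_ifs
        · have : ((Real.exp (x k ω) : ℝ) : ℂ) * (Real.exp (-x k ω) : ℝ) = 1 := by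
            rw [← Complex.ofReal_mul, ← Real.exp_add]; simp
          linear_combination Z k ω * this
        · simp
      simp_rw [e2, mul_sub]
      rw [integral_sub (hζi k |>.bdd_mul hWm (ae_of_all _ hWn))
          (hexpi.bdd_mul hWm (ae_of_all _ hWn)),
        integral_sub (integrable_condExp.bdd_mul hWm (ae_of_all _ hWn))
          (hexpi.bdd_mul hWm (ae_of_all _ hWn)),
        integral_mul_condExp_eq (ℱ.le k) hW hWn (hζi k)]
    rw [e1, ← integral_const_mul]
    refine norm_integral_le_of_norm_le ((hδi k).const_mul _) ?_
    filter_upwards [hcond k] with ω hω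
    by_cases h : p k ω
    · rw [norm_mul, if_pos h]
      exact mul_le_mul (hWn ω) hω (norm_nonneg _) (Real.exp_pos _).le
    · simp [W, h]
  have htot : ‖∫ ω, Z n ω ∂μ - 1‖ ≤ Real.exp B * θ := by
    have h1 : ∀ n, ‖∫ ω, Z n ω ∂μ - 1‖ ≤
        Real.exp B * ∑ k ∈ Finset.range n, ∫ ω, (if p k ω then δ k ω else 0) ∂μ := by
      intro n
      induction n with
      | zero => simp [Z]
      | succ n ih =>
        rw [Finset.sum_range_succ, mul_add]
        calc ‖∫ ω, Z (n + 1) ω ∂μ - 1‖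
            = ‖(∫ ω, Z n ω ∂μ - 1) + (∫ ω, Z (n + 1) ω ∂μ - ∫ ω, Z n ω ∂μ)‖ := by ring_nf
          _ ≤ _ := (norm_add_le _ _).trans (add_le_add ih (hstep n))
    refine (h1 n).trans (mul_le_mul_of_nonneg_left ?_ (Real.exp_pos _).le)
    rw [← integral_finsetSum _ fun k _ => hδi k]
    calc _ ≤ ∫ _, θ ∂μ := integral_mono (integrable_finsetSum _ fun k _ => hδi k)
          (integrable_const _) fun ω => sum_ite_le_of_forall_imp (fun j => hδ0 j ω) hθ.le
            (fun j (hj : p j ω) => hj.2) n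
      _ = θ := by simp
  set bad : Set Ω := {ω | θ < |∑ k ∈ Finset.range n, x k ω - σ| ∨
          θ < ∑ k ∈ Finset.range n, δ k ω} with hbad
  have hbadm : MeasurableSet bad := by
    have h1 : ∀ k, Measurable (x k) := fun k => (hx k).mono (ℱ.le k) le_rfl
    have h2 : ∀ k, Measurable (δ k) := fun k => (hδ k).mono (ℱ.le k) le_rfl
    have h3 : Measurable fun ω => |∑ k ∈ Finset.range n, x k ω - σ| := by fun_prop
    have h4 : Measurable fun ω => ∑ k ∈ Finset.range n, δ k ω := by fun_prop
    rw [hbad, Set.ofPred_or]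
    exact (measurableSet_lt measurable_const h3).union (measurableSet_lt measurable_const h4)
  have hprodn : ∀ ω, ‖∏ k ∈ Finset.range n, ζ k ω‖ ≤ 1 := fun ω => by
    rw [norm_prod]
    exact Finset.prod_le_one (fun _ _ => norm_nonneg _) fun k _ => hζ1 k ω
  have hprodi : Integrable (fun ω => ∏ k ∈ Finset.range n, ζ k ω) μ :=
    Integrable.of_bound (Finset.stronglyMeasurable_fun_prod _ fun j _ =>
      (hζ j).mono (ℱ.le _)).aestronglyMeasurable 1 (ae_of_all _ hprodn)
  have hpt : ∀ ω, ‖∏ k ∈ Finset.range n, ζ k ω - Z n ω * Real.exp (-σ)‖ ≤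
      Real.exp B * θ + (1 + Real.exp B) * bad.indicator 1 ω := by
    intro ω
    have hσ1 : Real.exp (-σ) ≤ 1 := Real.exp_le_one_iff.2 (by linarith)
    by_cases h : ω ∈ bad
    · rw [Set.indicator_of_mem h, Pi.one_apply, mul_one]
      have h1 : ‖Z n ω * Real.exp (-σ)‖ ≤ Real.exp B := by
        rw [norm_mul, Complex.norm_real, Real.norm_of_nonneg (Real.exp_pos _).le]
        nlinarith [hZn n ω, norm_nonneg (Z n ω), Real.exp_pos (-σ)]
      have : 0 ≤ Real.exp B * θ := by positivity
      linarith [norm_sub_le (∏ k ∈ Finset.range n, ζ k ω) (Z n ω * Real.exp (-σ)), hprodn ω]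
    · rw [Set.indicator_of_notMem h, mul_zero, add_zero]
      simp only [hbad, Set.mem_ofPred_eq, not_or, not_lt] at h
      have hle : ∀ {c : ℕ → Ω → ℝ}, (∀ k ω, 0 ≤ c k ω) → ∀ k < n,
          ∑ j ∈ Finset.range (k + 1), c j ω ≤ ∑ j ∈ Finset.range n, c j ω := fun hc k hk =>
        Finset.sum_le_sum_of_subset_of_nonneg (Finset.range_subset_range.2 hk)
          fun j _ _ => hc j ω
      have hpk : ∀ k < n, p k ω := fun k hk =>
        ⟨(hle hx0 k hk).trans (by linarith [(abs_le.1 h.1).2]), (hle hδ0 k hk).trans h.2⟩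
      have hZe : Z n ω = (∏ k ∈ Finset.range n, ζ k ω) *
          Real.exp (∑ k ∈ Finset.range n, x k ω) := by
        rw [Real.exp_sum, Complex.ofReal_prod, ← Finset.prod_mul_distrib]
        exact Finset.prod_congr rfl fun k hk => if_pos (hpk k (Finset.mem_range.1 hk))
      set T := ∑ k ∈ Finset.range n, x k ω with hT
      have e1 : ∏ k ∈ Finset.range n, ζ k ω - Z n ω * Real.exp (-σ) =
          (∏ k ∈ Finset.range n, ζ k ω) * ((1 - Real.exp (T - σ) : ℝ) : ℂ) := by
        rw [hZe, sub_eq_add_neg T, Real.exp_add]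
        push_cast; ring
      rw [e1, norm_mul, Complex.norm_real]
      have h2 : ‖1 - Real.exp (T - σ)‖ ≤ Real.exp B * θ := by
        have hB1 : 1 + 1 ≤ Real.exp B := by
          linarith [Real.add_one_le_exp B]
        rw [norm_sub_rev, Real.norm_eq_abs]
        have h3 := Real.norm_exp_sub_one_sub_id_le (x := T - σ) (by
          rw [Real.norm_eq_abs]; exact h.1.trans hθ1)
        rw [Real.norm_eq_abs, Real.norm_eq_abs] at h3
        have h4 : |Real.exp (T - σ) - 1| ≤ |Real.exp (T - σ) - 1 - (T - σ)| + |T - σ| := by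
          simpa using abs_add_le (Real.exp (T - σ) - 1 - (T - σ)) (T - σ)
        nlinarith [h.1, abs_nonneg (T - σ)]
      exact (mul_le_of_le_one_left (norm_nonneg _) (hprodn ω)).trans h2
  have hbi' : Integrable (fun ω => (1 + Real.exp B) * bad.indicator (1 : Ω → ℝ) ω) μ :=
    ((integrable_const (1 : ℝ)).indicator hbadm).const_mul _
  have hbi : Integrable (fun ω => Real.exp B * θ + (1 + Real.exp B) * bad.indicator 1 ω) μ :=
    (integrable_const _).add hbi'
  have h3 := norm_integral_le_of_norm_le hbi (ae_of_all _ hpt)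
  rw [integral_sub hprodi ((hZi n).mul_const _), integral_mul_const,
    integral_add (integrable_const _) hbi', integral_const_mul (1 + Real.exp B),
    integral_indicator_one hbadm, integral_const, probReal_univ,
    one_smul] at h3
  have e1 : ∫ ω, ∏ k ∈ Finset.range n, ζ k ω ∂μ - Real.exp (-σ) =
      (∫ ω, ∏ k ∈ Finset.range n, ζ k ω ∂μ - (∫ ω, Z n ω ∂μ) * Real.exp (-σ)) +
        (∫ ω, Z n ω ∂μ - 1) * Real.exp (-σ) := by ring
  have h4 : ‖(∫ ω, Z n ω ∂μ - 1) * Real.exp (-σ)‖ ≤ Real.exp B * θ := by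
    rw [norm_mul, Complex.norm_real, Real.norm_of_nonneg (Real.exp_pos _).le]
    exact (mul_le_of_le_one_right (norm_nonneg _)
      (Real.exp_le_one_iff.2 (by linarith))).trans htot
  rw [e1]
  refine (norm_add_le _ _).trans ((add_le_add h3 h4).trans (le_of_eq ?_))
  ring

/-! ### Convergence of martingales with summable moments of order `ρ` -/

/-- The expectation of `√(1 + S ^ 2)` grows at each step by at most twice the `ρ`-moment of the
increment. The partial sums are therefore bounded in `L¹`, and Doob's convergence theorem applies.
-/
theorem ae_exists_tendsto_sum_of_bdd_moment (ℱ : Filtration ℕ mΩ) {y : ℕ → Ω → ℝ}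
    (hy : ∀ k, StronglyMeasurable[ℱ (k + 1)] (y k)) (hyi : ∀ k, Integrable (y k) μ)
    (hy0 : ∀ k, μ[y k | ℱ k] =ᵐ[μ] 0) {ρ C : ℝ} (hρ : ρ ∈ Set.Icc (1 : ℝ) 2)
    (hyρ : ∀ k, Integrable (fun ω => |y k ω| ^ ρ) μ)
    (hC : ∀ n, ∑ k ∈ Finset.range n, ∫ ω, |y k ω| ^ ρ ∂μ ≤ C) :
    ∀ᵐ ω ∂μ, ∃ c, Tendsto (fun n => ∑ k ∈ Finset.range n, y k ω) atTop (𝓝 c) := by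
  let S : ℕ → Ω → ℝ := fun n ω => ∑ k ∈ Finset.range n, y k ω
  have hS : ∀ n, StronglyMeasurable[ℱ n] (S n) := fun n =>
    Finset.stronglyMeasurable_fun_sum _ fun j hj =>
      (hy j).mono (ℱ.mono (Finset.mem_range.1 hj))
  have hSi : ∀ n, Integrable (S n) μ := fun n => integrable_finsetSum _ fun k _ => hyi k
  have hmart : Martingale S ℱ μ := by
    refine martingale_of_condExp_sub_eq_zero_nat hS hSi fun k => ?_
    have : S (k + 1) - S k = y k := by
      ext ω
      simp [S, Finset.sum_range_succ]
    rw [this]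
    exact hy0 k
  have hsq : ∀ x : ℝ, |x| ≤ √(1 + x ^ 2) := fun x => Real.abs_le_sqrt (by linarith)
  have hφi : ∀ n, Integrable (fun ω => √(1 + S n ω ^ 2)) μ := fun n => by
    have hm := ((hS n).mono (ℱ.le n)).measurable
    refine Integrable.mono' (g := fun ω => 1 + ‖S n ω‖) ((integrable_const 1).add (hSi n).norm)
      (by fun_prop) (ae_of_all _ fun ω => ?_)
    rw [Real.norm_of_nonneg (Real.sqrt_nonneg _)]
    simp only [Real.norm_eq_abs]
    refine Real.sqrt_le_iff.2 ⟨by positivity, ?_⟩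
    nlinarith [abs_nonneg (S n ω), sq_abs (S n ω)]
  have hstep : ∀ n, ∫ ω, √(1 + S (n + 1) ω ^ 2) ∂μ ≤
      ∫ ω, √(1 + S n ω ^ 2) ∂μ + 2 * ∫ ω, |y n ω| ^ ρ ∂μ := by
    intro n
    -- The derivative of `√(1 + x ^ 2)` at `S n`. It is predictable and bounded by one, so its
    -- product with the centred increment has mean zero.
    let W : Ω → ℝ := fun ω => S n ω / √(1 + S n ω ^ 2)
    have hW : StronglyMeasurable[ℱ n] W := by
      have := (hS n).measurable
      exact (this.div (Real.continuous_sqrt.measurable.comp ((this.pow_const 2).const_add 1))).stronglyMeasurable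
    have hW1 : ∀ ω, ‖W ω‖ ≤ 1 := fun ω => by
      rw [Real.norm_eq_abs, abs_div, abs_of_nonneg (Real.sqrt_nonneg _)]
      exact div_le_one_of_le₀ (hsq _) (Real.sqrt_nonneg _)
    have hWi : Integrable (fun ω => W ω * y n ω) μ :=
      (hyi n).bdd_mul (hW.mono (ℱ.le n)).aestronglyMeasurable (ae_of_all _ hW1)
    have hW0 : ∫ ω, W ω * y n ω ∂μ = 0 := by
      have h := condExp_mul_of_stronglyMeasurable_left (μ := μ) hW hWi (hyi n)
      have h2 : ∫ ω, (W * y n) ω ∂μ = 0 := by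
        rw [← integral_condExp (ℱ.le n), integral_congr_ae h]
        refine integral_eq_zero_of_ae ?_
        filter_upwards [hy0 n] with ω hω
        simp [hω]
      exact h2
    have hi := (hφi n).add hWi
    calc ∫ ω, √(1 + S (n + 1) ω ^ 2) ∂μ
        ≤ ∫ ω, (√(1 + S n ω ^ 2) + W ω * y n ω + 2 * |y n ω| ^ ρ) ∂μ := by
          refine integral_mono (hφi _) (hi.add ((hyρ n).const_mul 2)) fun ω => ?_
          have : S (n + 1) ω = S n ω + y n ω := Finset.sum_range_succ _ _
          simp only [this]
          exact sqrt_one_add_sq_add_le hρ _ _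
      _ = ∫ ω, √(1 + S n ω ^ 2) ∂μ + 2 * ∫ ω, |y n ω| ^ ρ ∂μ := by
          rw [integral_add (by exact hi) ((hyρ n).const_mul 2), integral_add (hφi n) hWi, hW0,
            integral_const_mul, add_zero]
  have hbd : ∀ n, ∫ ω, √(1 + S n ω ^ 2) ∂μ ≤ 1 + 2 * C := by
    have h1 : ∀ n, ∫ ω, √(1 + S n ω ^ 2) ∂μ ≤
        1 + 2 * ∑ k ∈ Finset.range n, ∫ ω, |y k ω| ^ ρ ∂μ := by
      intro n
      induction n with
      | zero => simp [S]
      | succ n ih =>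
        rw [Finset.sum_range_succ]
        linarith [hstep n]
    intro n
    linarith [h1 n, hC n]
  refine hmart.submartingale.exists_ae_tendsto_of_bdd (R := (1 + 2 * C).toNNReal) fun n => ?_
  rw [eLpNorm_one_eq_lintegral_enorm, ← ofReal_integral_norm_eq_lintegral_enorm (hSi n)]
  refine ENNReal.ofReal_le_ofReal ((integral_mono (hSi n).norm (hφi n) fun ω => ?_).trans (hbd n))
  exact hsq _

end Product

/-! ### Markov property and conditional laws of the increments -/

section MarkovProperty

variable {Ω E : Type*} [mΩ : MeasurableSpace Ω] [mE : MeasurableSpace E] {μ : Measure Ω}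
  {Q : ℝ≥0 → Kernel E E} {γ : ℕ → ℝ≥0} {X : ℕ → Ω → E}

/-- The filtration generated by a sequence of random variables. -/
def historyFiltration (hX : ∀ n, Measurable (X n)) : Filtration ℕ mΩ where
  seq := history X
  mono' _ _ h := iSup₂_mono' fun k hk => ⟨k, hk.trans h, le_rfl⟩
  le' _ := iSup₂_le fun k _ => (hX k).comap_le

theorem measurable_history {Ω : Type*} (X : ℕ → Ω → E) {k n : ℕ} (hkn : k ≤ n) :
    Measurable[history X n] (X k) :=
  (comap_measurable (X k)).mono
    (le_iSup₂_of_le (f := fun k (_ : k ≤ n) => MeasurableSpace.comap (X k) inferInstance)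
      k hkn le_rfl) le_rfl

theorem IsMarkovScheme.history_le (hX : IsMarkovScheme μ Q γ X) (n : ℕ) : history X n ≤ mΩ :=
  (historyFiltration hX.measurable).le n

/-- `(x, y) ↦ -(f y - q f x)`. -/
noncomputable def centredIncrement (q : Kernel E E) (f : E → ℝ) (z : E × E) : ℝ :=
  -(f z.2 - ∫ y, f y ∂(q z.1))

theorem measurable_centredIncrement (q : Kernel E E) [IsMarkovKernel q] {f : E → ℝ}
    (hf : Measurable f) : Measurable (centredIncrement q f) := by
  have : Measurable fun x => ∫ y, f y ∂(q x) :=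
    (StronglyMeasurable.integral_kernel_prod_right' (κ := q)
      (hf.comp measurable_snd).stronglyMeasurable).measurable
  exact ((hf.comp measurable_snd).sub (this.comp measurable_fst)).neg

theorem integrable_centredIncrement {q : Kernel E E} [IsMarkovKernel q] {f : E → ℝ} {x : E}
    (hf : Integrable f (q x)) : Integrable (fun y => centredIncrement q f (x, y)) (q x) :=
  (hf.sub (integrable_const (∫ y, f y ∂(q x)))).neg

theorem integral_centredIncrement {q : Kernel E E} [IsMarkovKernel q] {f : E → ℝ} {x : E}
    (hf : Integrable f (q x)) : ∫ y, centredIncrement q f (x, y) ∂(q x) = 0 := by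
  simp only [centredIncrement]
  rw [integral_neg, integral_sub hf (integrable_const _)]
  simp

variable [∀ s, IsMarkovKernel (Q s)]

theorem IsMarkovScheme.measurable_increment_pair (hX : IsMarkovScheme μ Q γ X) {f : E → ℝ}
    (hf : Measurable f) (n : ℕ) {z : Ω → ℝ} (hz : Measurable z) : Measurable fun ω =>
    (z ω, centredIncrement (Q (γ (n + 1))) f (X n ω, X (n + 1) ω)) :=
  hz.prodMk ((measurable_centredIncrement _ hf).comp
    ((hX.measurable n).prodMk (hX.measurable (n + 1))))

variable [IsProbabilityMeasure μ]

/-- The joint law of two consecutive states, on an event of the past. -/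
theorem IsMarkovScheme.map_restrict (hX : IsMarkovScheme μ Q γ X) (n : ℕ) {A : Set Ω}
    (hA : MeasurableSet[history X n] A) :
    (μ.restrict A).map (fun ω => (X n ω, X (n + 1) ω)) =
      ((μ.restrict A).map (X n)) ⊗ₘ Q (γ (n + 1)) := by
  have hm := hX.measurable
  refine Measure.ext_prod fun {B C} hB hC => ?_
  have hBA : MeasurableSet[history X n] (X n ⁻¹' B ∩ A) :=
    (measurable_history X le_rfl hB).inter hA
  have hBA' := hX.history_le n _ hBA
  have hcond : ∫ ω in X n ⁻¹' B ∩ A, (Q (γ (n + 1)) (X n ω)).real C ∂μ =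
      μ.real (X (n + 1) ⁻¹' C ∩ (X n ⁻¹' B ∩ A)) := by
    have h1 := setIntegral_condExp (μ := μ) (hX.history_le n)
      (f := (X (n + 1) ⁻¹' C).indicator fun _ => (1 : ℝ))
      ((integrable_const _).indicator (hm _ hC)) hBA
    rw [setIntegral_congr_ae hBA' ((hX.transition n C hC).mono fun ω hω _ => hω)] at h1
    rw [h1]
    have := integral_indicator_one (μ := μ.restrict (X n ⁻¹' B ∩ A)) (hm (n + 1) hC)
    rw [measureReal_restrict_apply (hm _ hC)] at this
    exact this
  have hmeas : Measurable fun ω => Q (γ (n + 1)) (X n ω) C :=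
    (Kernel.measurable_coe _ hC).comp (hm n)
  rw [Measure.map_apply ((hm n).prodMk (hm (n + 1))) (hB.prod hC),
    Measure.compProd_apply_prod hB hC, setLIntegral_map hB (Kernel.measurable_coe _ hC) (hm n),
    Measure.restrict_restrict (hm n hB), Set.mk_preimage_prod,
    Measure.restrict_apply ((hm n hB).inter (hm _ hC))]
  rw [← ENNReal.toReal_eq_toReal_iff' (measure_ne_top _ _) (ne_of_lt (lt_of_le_of_lt
      (lintegral_mono (g := fun _ => 1) fun ω => prob_le_one) (by simp)))]
  rw [← integral_toReal hmeas.aemeasurable (ae_of_all _ fun ω => measure_lt_top _ _)]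
  change μ.real _ = ∫ ω in X n ⁻¹' B ∩ A, (Q (γ (n + 1)) (X n ω)).real C ∂μ
  rw [hcond]
  congr 1
  ext ω
  simp only [Set.mem_inter_iff]
  tauto

theorem IsMarkovScheme.map_pair (hX : IsMarkovScheme μ Q γ X) (n : ℕ) :
    μ.map (fun ω => (X n ω, X (n + 1) ω)) = μ.map (X n) ⊗ₘ Q (γ (n + 1)) := by
  simpa using hX.map_restrict n MeasurableSet.univ

theorem IsMarkovScheme.setLIntegral_pair (hX : IsMarkovScheme μ Q γ X) (n : ℕ) {A : Set Ω}
    (hA : MeasurableSet[history X n] A) {φ : E × E → ℝ≥0∞} (hφ : Measurable φ) :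
    ∫⁻ ω in A, φ (X n ω, X (n + 1) ω) ∂μ =
      ∫⁻ ω in A, ∫⁻ y, φ (X n ω, y) ∂(Q (γ (n + 1)) (X n ω)) ∂μ := by
  have hm := hX.measurable
  rw [← lintegral_map (μ := μ.restrict A) hφ ((hm n).prodMk (hm (n + 1))), hX.map_restrict n hA,
    Measure.lintegral_compProd hφ, lintegral_map hφ.lintegral_kernel_prod_right' (hm n)]

theorem IsMarkovScheme.setIntegral_pair {F : Type*} [NormedAddCommGroup F] [NormedSpace ℝ F]
    (hX : IsMarkovScheme μ Q γ X) (n : ℕ) {A : Set Ω} (hA : MeasurableSet[history X n] A)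
    {φ : E × E → F} (hφ : StronglyMeasurable φ)
    (hi : IntegrableOn (fun ω => φ (X n ω, X (n + 1) ω)) A μ) :
    IntegrableOn (fun ω => ∫ y, φ (X n ω, y) ∂(Q (γ (n + 1)) (X n ω))) A μ ∧
    ∫ ω in A, φ (X n ω, X (n + 1) ω) ∂μ =
      ∫ ω in A, ∫ y, φ (X n ω, y) ∂(Q (γ (n + 1)) (X n ω)) ∂μ := by
  have hm := hX.measurable
  have hpair : Measurable fun ω => (X n ω, X (n + 1) ω) := (hm n).prodMk (hm (n + 1))
  have hsm : StronglyMeasurable fun x => ∫ y, φ (x, y) ∂(Q (γ (n + 1)) x) :=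
    hφ.integral_kernel_prod_right'
  have hint : Integrable φ (((μ.restrict A).map (X n)) ⊗ₘ Q (γ (n + 1))) := by
    rw [← hX.map_restrict n hA, integrable_map_measure hφ.aestronglyMeasurable hpair.aemeasurable]
    exact hi
  constructor
  · have h1 := ((Measure.integrable_compProd_iff hφ.aestronglyMeasurable).1 hint).2
    have h2 := h1.mono' hsm.aestronglyMeasurable
      (ae_of_all _ fun x => norm_integral_le_integral_norm _)
    rw [integrable_map_measure hsm.aestronglyMeasurable (hm n).aemeasurable] at h2
    exact h2
  · have h1 : ∫ ω in A, φ (X n ω, X (n + 1) ω) ∂μ =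
        ∫ z, φ z ∂((μ.restrict A).map (fun ω => (X n ω, X (n + 1) ω))) :=
      (integral_map hpair.aemeasurable hφ.aestronglyMeasurable).symm
    rw [h1, hX.map_restrict n hA, Measure.integral_compProd hint,
      integral_map (hm n).aemeasurable hsm.aestronglyMeasurable]

theorem IsMarkovScheme.condExp_pair {F : Type*} [NormedAddCommGroup F] [NormedSpace ℝ F]
    [CompleteSpace F] (hX : IsMarkovScheme μ Q γ X) (n : ℕ) {φ : E × E → F}
    (hφ : StronglyMeasurable φ) (hi : Integrable (fun ω => φ (X n ω, X (n + 1) ω)) μ) :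
    μ[fun ω => φ (X n ω, X (n + 1) ω) | history X n] =ᵐ[μ]
      fun ω => ∫ y, φ (X n ω, y) ∂(Q (γ (n + 1)) (X n ω)) := by
  have hsm : StronglyMeasurable fun x => ∫ y, φ (x, y) ∂(Q (γ (n + 1)) x) :=
    hφ.integral_kernel_prod_right'
  exact (ae_eq_condExp_of_forall_setIntegral_eq (hX.history_le n) hi
    (fun A hA _ => (hX.setIntegral_pair n hA hφ hi.integrableOn).1)
    (fun A hA _ => (hX.setIntegral_pair n hA hφ hi.integrableOn).2.symm)
    (hsm.comp_measurable (measurable_history X le_rfl)).aestronglyMeasurable).symm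

theorem IsMarkovScheme.condLExp_pair (hX : IsMarkovScheme μ Q γ X) (n : ℕ) {φ : E × E → ℝ≥0∞}
    (hφ : Measurable φ) :
    condLExp (present X n) μ (fun ω => φ (X n ω, X (n + 1) ω)) =ᵐ[μ]
      fun ω => ∫⁻ y, φ (X n ω, y) ∂(Q (γ (n + 1)) (X n ω)) := by
  have hle : present X n ≤ history X n :=
    le_iSup₂_of_le (f := fun k (_ : k ≤ n) => MeasurableSpace.comap (X k) inferInstance)
      n le_rfl le_rfl
  refine (ae_eq_condLExp (hX.measurable n).comap_le μ _
    (hφ.lintegral_kernel_prod_right'.comp (comap_measurable (X n))) fun A hA => ?_).symm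
  exact (hX.setLIntegral_pair n (hle A hA) hφ).symm

/-- The conditional law given the present of a joint variable whose second component is a function
of two consecutive states. -/
theorem IsMarkovScheme.condDistrib_map_snd (hX : IsMarkovScheme μ Q γ X) (n : ℕ) {z : Ω → ℝ}
    (hz : Measurable z) {D : E × E → ℝ} (hD : Measurable D) :
    ∀ᵐ ω ∂μ, (condDistrib (fun ω => (z ω, D (X n ω, X (n + 1) ω))) (X n) μ (X n ω)).map Prod.snd =
      (Q (γ (n + 1)) (X n ω)).map (fun y => D (X n ω, y)) := by
  have hm := hX.measurable
  have hpair : Measurable fun ω => (X n ω, X (n + 1) ω) := (hm n).prodMk (hm (n + 1))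
  have hDm : Measurable fun ω => D (X n ω, X (n + 1) ω) := hD.comp hpair
  have h1 := condDistrib_comp (mβ := mE) (μ := μ) (X n) (Y := fun ω => (z ω, D (X n ω, X (n + 1) ω)))
    (hz.prodMk hDm).aemeasurable measurable_snd
  have happ : ∀ x, ((Kernel.id ×ₖ Q (γ (n + 1))).map D) x =
      (Q (γ (n + 1)) x).map (fun y => D (x, y)) := fun x => by
    rw [Kernel.map_apply _ hD, Kernel.prod_apply, Kernel.id_apply, Measure.dirac_prod,
      Measure.map_map hD measurable_prodMk_left]
    rfl
  have h2 : condDistrib (fun ω => D (X n ω, X (n + 1) ω)) (X n) μ =ᵐ[μ.map (X n)]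
      (Kernel.id ×ₖ Q (γ (n + 1))).map D := by
    have : IsMarkovKernel ((Kernel.id ×ₖ Q (γ (n + 1))).map D) := Kernel.IsMarkovKernel.map _ hD
    refine condDistrib_ae_eq_of_measure_eq_compProd _ hDm.aemeasurable ?_
    ext s hs
    have hg : Measurable fun p : E × E => (p.1, D p) := measurable_fst.prodMk hD
    have e : (fun ω => (X n ω, D (X n ω, X (n + 1) ω))) =
        (fun p : E × E => (p.1, D p)) ∘ fun ω => (X n ω, X (n + 1) ω) := rfl
    rw [e, ← Measure.map_map hg hpair, hX.map_pair, Measure.map_apply hg hs,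
      Measure.compProd_apply (hg hs), Measure.compProd_apply hs]
    refine lintegral_congr fun x => ?_
    rw [happ, Measure.map_apply (by exact hD.comp measurable_prodMk_left)
      (measurable_prodMk_left hs)]
    rfl
  filter_upwards [ae_of_ae_map (hm n).aemeasurable h1, ae_of_ae_map (hm n).aemeasurable h2]
    with ω w1 w2
  have w3 : condDistrib (Prod.snd ∘ fun ω => (z ω, D (X n ω, X (n + 1) ω))) (X n) μ =
    condDistrib (fun ω => D (X n ω, X (n + 1) ω)) (X n) μ := rfl
  rw [w3, w2, happ, Kernel.map_apply _ measurable_snd] at w1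
  exact w1.symm

/-- The moment bound of the growth control is stated with values in `[0,∞]`, so the disintegration
must hold without prior integrability. The bound itself then yields integrability under the
conditional law. -/
theorem condLExp_ae_eq_lintegral_condDistrib {S : Type*} [MeasurableSpace S] [StandardBorelSpace S]
    [Nonempty S] {x : Ω → E} (hx : Measurable x) {Y : Ω → S} (hY : Measurable Y) {φ : S → ℝ≥0∞}
    (hφ : Measurable φ) :
    condLExp (MeasurableSpace.comap x inferInstance) μ (fun ω => φ (Y ω)) =ᵐ[μ]
      fun ω => ∫⁻ s, φ s ∂(condDistrib Y x μ (x ω)) := by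
  have hmeas : Measurable fun a => ∫⁻ s, φ s ∂(condDistrib Y x μ a) := hφ.lintegral_kernel
  refine (ae_eq_condLExp hx.comap_le μ _ ?_ ?_).symm
  · exact hmeas.comp (comap_measurable x)
  · rintro _ ⟨B, hB, rfl⟩
    have h1 : Measurable fun p : E × S => φ p.2 := hφ.comp measurable_snd
    have h2 := Measure.setLIntegral_compProd (μ := μ.map x) (κ := condDistrib Y x μ) h1 hB
      MeasurableSet.univ
    rw [compProd_map_condDistrib hY.aemeasurable,
      setLIntegral_map (hB.prod MeasurableSet.univ) h1 (hx.prodMk hY)] at h2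
    simp only [Measure.restrict_univ] at h2
    rw [setLIntegral_map hB hmeas hx, Set.mk_preimage_prod, Set.preimage_univ,
      Set.inter_univ] at h2
    exact h2.symm

/-- The conditional law of `(Z, D(X_n, X_{n+1}))` given `X_n`, where
`D(x, y) = -(f y - q f x)`. -/
noncomputable def incrementKernel (μ : Measure Ω) [IsProbabilityMeasure μ] (q : Kernel E E)
    (f : E → ℝ) (X : ℕ → Ω → E) (z : Ω → ℝ) (n : ℕ) : Kernel E (ℝ × ℝ) :=
  condDistrib (fun ω => (z ω, centredIncrement q f (X n ω, X (n + 1) ω))) (X n) μ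

instance (q : Kernel E E) (f : E → ℝ) (z : Ω → ℝ) (n : ℕ) :
    IsMarkovKernel (incrementKernel μ q f X z n) := by
  unfold incrementKernel; infer_instance

section IncrementKernel

theorem IsMarkovScheme.condExp_incrementKernel (hX : IsMarkovScheme μ Q γ X) {f : E → ℝ}
    (hf : Measurable f) (n : ℕ) {z : Ω → ℝ} (hz : Measurable z)
    {φ : ℝ → ℝ} (hφ : Measurable φ)
    (hi : Integrable (fun ω => φ (z ω)) μ) :
    μ[fun ω => φ (z ω) | present X n] =ᵐ[μ]
      fun ω => ∫ p, φ p.1 ∂(incrementKernel μ (Q (γ (n + 1))) f X z n (X n ω)) :=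
  condExp_ae_eq_integral_condDistrib (hX.measurable n)
    (hX.measurable_increment_pair hf n hz).aemeasurable (f := fun p : ℝ × ℝ => φ p.1)
    (hφ.comp measurable_fst).stronglyMeasurable hi

theorem IsMarkovScheme.integrable_incrementKernel (hX : IsMarkovScheme μ Q γ X) {f : E → ℝ}
    (hf : Measurable f) (n : ℕ) {z : Ω → ℝ} (hz : Measurable z)
    {φ : ℝ → ℝ} (hφ : Measurable φ)
    (hi : Integrable (fun ω => φ (z ω)) μ) :
    ∀ᵐ ω ∂μ, Integrable (fun p => φ p.1) (incrementKernel μ (Q (γ (n + 1))) f X z n (X n ω)) := by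
  have hY := hX.measurable_increment_pair hf n hz
  refine Integrable.condDistrib_ae (f := fun p : E × (ℝ × ℝ) => φ p.2.1)
    (hX.measurable n).aemeasurable hY.aemeasurable ?_
  rw [integrable_map_measure
    (by exact (hφ.comp (measurable_fst.comp measurable_snd)).aestronglyMeasurable)
    ((hX.measurable n).prodMk hY).aemeasurable]
  exact hi

theorem IsMarkovScheme.moment_incrementKernel (hX : IsMarkovScheme μ Q γ X) {f : E → ℝ}
    (hf : Measurable f) (n : ℕ) {z : Ω → ℝ} (hz : Measurable z)
    {ρ : ℝ} {m : Ω → ℝ≥0}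
    (hm : condLExp (present X n) μ (fun ω => ENNReal.ofReal
        (|centredIncrement (Q (γ (n + 1))) f (X n ω, X (n + 1) ω) - z ω| ^ ρ))
      ≤ᵐ[μ] fun ω => (m ω : ℝ≥0∞)) :
    ∀ᵐ ω ∂μ, Integrable (fun p => |p.2 - p.1| ^ ρ)
        (incrementKernel μ (Q (γ (n + 1))) f X z n (X n ω)) ∧
      ∫ p, |p.2 - p.1| ^ ρ ∂(incrementKernel μ (Q (γ (n + 1))) f X z n (X n ω)) ≤ m ω := by
  have hφ : Measurable fun p : ℝ × ℝ => |p.2 - p.1| ^ ρ := by fun_prop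
  have h := condLExp_ae_eq_lintegral_condDistrib (μ := μ) (hX.measurable n)
    (hX.measurable_increment_pair hf n hz) hφ.ennreal_ofReal
  filter_upwards [hm, h] with ω h1 h2
  rw [h2] at h1
  have h0 : ∀ p : ℝ × ℝ, 0 ≤ |p.2 - p.1| ^ ρ := fun p => Real.rpow_nonneg (abs_nonneg _) _
  have hi : Integrable (fun p => |p.2 - p.1| ^ ρ)
      (incrementKernel μ (Q (γ (n + 1))) f X z n (X n ω)) := by
    refine ⟨hφ.aestronglyMeasurable, ?_⟩
    rw [hasFiniteIntegral_iff_ofReal (ae_of_all _ h0)]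
    exact h1.trans_lt ENNReal.coe_lt_top
  refine ⟨hi, ?_⟩
  rw [integral_eq_lintegral_of_nonneg_ae (ae_of_all _ h0) hφ.aestronglyMeasurable]
  exact ENNReal.toReal_le_coe_of_le_coe h1

/-- The exceptional null set does not depend on `φ`, since the second marginal of the conditional
law is identified as a measure. -/
theorem IsMarkovScheme.integral_snd_incrementKernel (hX : IsMarkovScheme μ Q γ X) {f : E → ℝ}
    (hf : Measurable f) (n : ℕ) {z : Ω → ℝ} (hz : Measurable z) :
    ∀ᵐ ω ∂μ, ∀ φ : ℝ → ℂ, Measurable φ →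
      ∫ p, φ p.2 ∂(incrementKernel μ (Q (γ (n + 1))) f X z n (X n ω)) =
        ∫ y, φ (centredIncrement (Q (γ (n + 1))) f (X n ω, y)) ∂(Q (γ (n + 1)) (X n ω)) := by
  have hD := measurable_centredIncrement (Q (γ (n + 1))) hf
  filter_upwards [hX.condDistrib_map_snd n hz hD] with ω hω φ hφ
  rw [← integral_map (φ := Prod.snd) (by fun_prop) hφ.aestronglyMeasurable]
  unfold incrementKernel
  rw [hω, integral_map (by exact (hD.comp measurable_prodMk_left).aemeasurable)
    hφ.aestronglyMeasurable]

theorem IsMarkovScheme.centred_snd_incrementKernel (hX : IsMarkovScheme μ Q γ X) {f : E → ℝ}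
    (hf : Measurable f) (n : ℕ) {z : Ω → ℝ} (hz : Measurable z)
    (hfQ : ∀ x, Integrable f (Q (γ (n + 1)) x)) :
    ∀ᵐ ω ∂μ, Integrable (fun p => p.2) (incrementKernel μ (Q (γ (n + 1))) f X z n (X n ω)) ∧
      ∫ p, p.2 ∂(incrementKernel μ (Q (γ (n + 1))) f X z n (X n ω)) = 0 := by
  have hD := measurable_centredIncrement (Q (γ (n + 1))) hf
  filter_upwards [hX.condDistrib_map_snd n hz hD] with ω hω
  have hDω : AEMeasurable (fun y => centredIncrement (Q (γ (n + 1))) f (X n ω, y))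
    (Q (γ (n + 1)) (X n ω)) := (hD.comp measurable_prodMk_left).aemeasurable
  have h1 := integrable_centredIncrement (hfQ (X n ω))
  have h2 := integral_centredIncrement (hfQ (X n ω))
  constructor
  · have : Integrable id ((incrementKernel μ (Q (γ (n + 1))) f X z n (X n ω)).map Prod.snd) := by
      unfold incrementKernel
      rw [hω, integrable_map_measure (by fun_prop) hDω]
      exact h1
    rw [integrable_map_measure (by fun_prop) (by fun_prop)] at this
    exact this
  · have : ∫ r, r ∂((incrementKernel μ (Q (γ (n + 1))) f X z n (X n ω)).map Prod.snd) = 0 := by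
      unfold incrementKernel
      rw [hω, integral_map hDω (by fun_prop)]
      exact h2
    rw [integral_map (by fun_prop) (by fun_prop)] at this
    exact this

end IncrementKernel

end MarkovProperty

/-! ### Reindexing of weighted sums -/

theorem sum_Icc_one_eq_sum_range {M : Type*} [AddCommMonoid M] (F : ℕ → M) (n : ℕ) :
    ∑ k ∈ Finset.Icc 1 n, F k = ∑ k ∈ Finset.range n, F (k + 1) := by
  induction n with
  | zero => simp
  | succ n ih => rw [Finset.sum_Icc_succ_top (by omega), Finset.sum_range_succ, ih]

theorem coe_partialSum (w : ℕ → ℝ≥0) (n : ℕ) :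
    (partialSum w n : ℝ) = ∑ k ∈ Finset.range n, (w (k + 1) : ℝ) := by
  rw [partialSum, sum_Icc_one_eq_sum_range, NNReal.coe_sum]

theorem monotone_partialSum (w : ℕ → ℝ≥0) : Monotone (partialSum w) :=
  monotone_nat_of_le_succ fun n => by
    rw [partialSum, partialSum, Finset.sum_Icc_succ_top (by omega)]
    exact le_self_add

theorem IsWeightSequence.tendsto_coe {w : ℕ → ℝ≥0} (hw : IsWeightSequence w) :
    Tendsto (fun n => (partialSum w n : ℝ)) atTop atTop :=
  NNReal.tendsto_coe_atTop.2 hw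

theorem integral_empiricalMeasure_eq_sum_range {Ω E : Type*} [MeasurableSpace E]
    [MeasurableSingletonClass E] (w : ℕ → ℝ≥0) (X : ℕ → Ω → E) (n : ℕ) (ω : Ω) (f : E → ℝ) :
    ∫ x, f x ∂(empiricalMeasure w X n ω) =
      (∑ k ∈ Finset.range n, (w (k + 1) : ℝ) * f (X k ω)) / (partialSum w n : ℝ) := by
  rw [integral_empiricalMeasure, sum_Icc_one_eq_sum_range, inv_mul_eq_div]
  simp

theorem tendsto_measureReal_of_tendstoInMeasure {Ω : Type*} [MeasurableSpace Ω] {μ : Measure Ω}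
    {Y : ℕ → Ω → ℝ} {a : ℝ}
    (h : TendstoInMeasure μ Y atTop fun _ => a) {e : ℝ} (he : 0 < e) :
    Tendsto (fun n => μ.real {ω | e ≤ |Y n ω - a|}) atTop (𝓝 0) := by
  rw [tendstoInMeasure_iff_norm] at h
  have := (ENNReal.tendsto_toReal ENNReal.zero_ne_top).comp (h e he)
  simpa [Function.comp_def, measureReal_def] using this

/-- Weighted averages along the chain of the function `g` of the step-weight condition. -/
theorem StepWeightCondition.tendsto_average {Ω E : Type*} [MeasurableSpace Ω] {μ : Measure Ω}
    {γ : ℕ → ℝ≥0} {X : ℕ → Ω → E} {g : E → ℝ≥0} {ρ : ℝ} (hρ : ρ ∈ Set.Icc (1 : ℝ) 2)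
    {εX εGC : ℝ≥0 → ℝ≥0} (hw : IsWeightSequence fun n => εX (γ n))
    (hSW : StepWeightCondition μ γ X g ρ εX εGC) :
    ∀ᵐ ω ∂μ, Tendsto (fun n => (∑ k ∈ Finset.range n, (εGC (γ (k + 1)) : ℝ) * (g (X k ω) : ℝ)) /
      (partialSum (fun k => εX (γ k)) n : ℝ) ^ (ρ / 2)) atTop (𝓝 0) := by
  filter_upwards [hSW] with ω hω
  have hρ0 : 0 < ρ / 2 := by linarith [hρ.1]
  refine tendsto_sum_div_of_tendsto_sum_div (c := ∑' n : ℕ, (εGC (γ (n + 1)) : ℝ) /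
    (partialSum (fun k => εX (γ k)) (n + 1) : ℝ) ^ (ρ / 2) * (g (X n ω) : ℝ)) ?_ ?_ ?_ ?_
  · simp [partialSum, hρ0.ne']
  · intro i j hij
    exact Real.rpow_le_rpow (NNReal.coe_nonneg _)
      (NNReal.coe_le_coe.2 (monotone_partialSum _ hij)) hρ0.le
  · exact (tendsto_rpow_atTop hρ0).comp hw.tendsto_coe
  · refine hω.hasSum.tendsto_sum_nat.congr fun n => Finset.sum_congr rfl fun k _ => ?_
    ring

theorem measurable_integral_kernel_history {Ω E : Type*} [MeasurableSpace E] {X : ℕ → Ω → E} (κ : Kernel E (ℝ × ℝ)) [IsMarkovKernel κ] {φ : ℝ → ℝ}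
    (hφ : Measurable φ) (n : ℕ) :
    Measurable[history X n] fun ω => ∫ p, φ p.1 ∂(κ (X n ω)) := by
  have h : StronglyMeasurable fun x => ∫ p, φ p.1 ∂(κ x) :=
    StronglyMeasurable.integral_kernel_prod_right' (κ := κ)
      (f := fun q : E × (ℝ × ℝ) => φ q.2.1)
      (hφ.comp (measurable_fst.comp measurable_snd)).stronglyMeasurable
  exact h.measurable.comp (measurable_history X le_rfl)

theorem measurable_indicator_sq (e : ℝ) :
    Measurable ({x : ℝ | e < |x|}.indicator fun x => x ^ 2) :=
  (by fun_prop : Measurable fun x : ℝ => x ^ 2).indicator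
    (measurableSet_lt measurable_const (by fun_prop))

/-! ### Characteristic functions along the chain -/

section CLT

variable {Ω E : Type*} [mΩ : MeasurableSpace Ω] [mE : MeasurableSpace E] {μ : Measure Ω}
  {Q : ℝ≥0 → Kernel E E} {γ : ℕ → ℝ≥0} {X : ℕ → Ω → E}
  [∀ s, IsMarkovKernel (Q s)] [IsProbabilityMeasure μ]

/-- The product estimate needs conditioning on the whole past, while the hypotheses on `z` condition
on `X n` alone. The left side involves only `X n` and `X (n + 1)`, so by the Markov property it is
an integral under the conditional law of the pair given `X n`, where `norm_integral_exp_sub_le`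
applies pointwise. -/
theorem IsMarkovScheme.norm_condExp_exp_sub_le (hX : IsMarkovScheme μ Q γ X) {f : E → ℝ}
    (hf : Measurable f) (n : ℕ) {z : Ω → ℝ} (hz : Measurable z)
    (hfQ : ∀ x, Integrable f (Q (γ (n + 1)) x)) (hz2 : MemLp z 2 μ)
    (hz0 : μ[z | present X n] =ᵐ[μ] 0) {ρ δ e : ℝ} {m : Ω → ℝ≥0} (hρ : ρ ∈ Set.Icc (1 : ℝ) 2)
    (hm : condLExp (present X n) μ (fun ω => ENNReal.ofReal
        (|centredIncrement (Q (γ (n + 1))) f (X n ω, X (n + 1) ω) - z ω| ^ ρ))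
      ≤ᵐ[μ] fun ω => (m ω : ℝ≥0∞))
    (hδ : 0 < δ) (hδ1 : δ ≤ 1) (he : 0 ≤ e) (a : ℝ) :
    ∀ᵐ ω ∂μ, ‖(μ[fun ω => Complex.exp
          ((a * centredIncrement (Q (γ (n + 1))) f (X n ω, X (n + 1) ω) : ℝ) * Complex.I) |
            history X n]) ω
        - Real.exp (-(a ^ 2 *
          (∫ p, p.1 ^ 2 ∂(incrementKernel μ (Q (γ (n + 1))) f X z n (X n ω))) / 2))‖ ≤
      (3 + 2 / δ) * (|a| ^ ρ * m ω)
        + (δ * a ^ 2 + 4 * (|a| * e) * a ^ 2 + a ^ 4 * e ^ 2) *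
          (∫ p, p.1 ^ 2 ∂(incrementKernel μ (Q (γ (n + 1))) f X z n (X n ω)))
        + 5 * a ^ 2 * ∫ p, {x : ℝ | e < |x|}.indicator (fun x => x ^ 2) p.1
          ∂(incrementKernel μ (Q (γ (n + 1))) f X z n (X n ω)) := by
  have hD := measurable_centredIncrement (Q (γ (n + 1))) hf
  have hφ : Measurable fun r : ℝ => Complex.exp ((a * r : ℝ) * Complex.I) := by fun_prop
  have hψ := hφ.comp hD
  have h1 := hX.condExp_pair n hψ.stronglyMeasurable
    (Integrable.of_bound (hψ.comp ((hX.measurable n).prodMk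
      (hX.measurable (n + 1)))).aestronglyMeasurable 1 (ae_of_all _ fun ω => by
        simp only [Function.comp_apply]
        rw [Complex.norm_exp_ofReal_mul_I]))
  have hzi : Integrable z μ := hz2.integrable one_le_two
  filter_upwards [h1, hX.integral_snd_incrementKernel hf n hz,
    hX.centred_snd_incrementKernel hf n hz hfQ, hX.moment_incrementKernel hf n hz hm,
    hX.integrable_incrementKernel hf n hz (φ := fun x => x ^ 2) (by fun_prop) hz2.integrable_sq,
    hX.condExp_incrementKernel hf n hz measurable_id hzi, hz0] with ω w1 w2 w3 w4 w5 w6 w7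
  have e1 := w2 _ hφ
  have w8 : ∫ p, p.1 ∂(incrementKernel μ (Q (γ (n + 1))) f X z n (X n ω)) = 0 := by
    exact w6.symm.trans w7
  have e2 : (μ[fun ω => Complex.exp
          ((a * centredIncrement (Q (γ (n + 1))) f (X n ω, X (n + 1) ω) : ℝ) * Complex.I) |
            history X n]) ω =
      ∫ p, Complex.exp ((a * p.2 : ℝ) * Complex.I)
        ∂(incrementKernel μ (Q (γ (n + 1))) f X z n (X n ω)) := by
    rw [e1]; exact w1
  rw [e2]
  exact norm_integral_exp_sub_le measurable_fst w5 w8 measurable_snd w3.1 w3.2 hρ hδ hδ1 he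
    w4.1 w4.2 a

variable [MeasurableSingletonClass E]

set_option maxHeartbeats 1000000 in
/-- The characteristic function of the normalised sums of centred increments. -/
theorem IsMarkovScheme.tendsto_integral_exp (hX : IsMarkovScheme μ Q γ X) {f Vf : E → ℝ}
    (hf : Measurable f) (hfQ : ∀ n x, Integrable f (Q (γ (n + 1)) x)) {ν : Measure E}
    {g : E → ℝ≥0} (hg : Measurable g) {ρ : ℝ} (hρ : ρ ∈ Set.Icc (1 : ℝ) 2) {εX εGC : ℝ≥0 → ℝ≥0}
    (hw : IsWeightSequence fun n => εX (γ n)) (hGC : GrowthControl μ Q ν γ X g ρ εX εGC f Vf)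
    (hSW : StepWeightCondition μ γ X g ρ εX εGC) :
    0 ≤ ∫ x, Vf x ∂ν ∧ ∀ t : ℝ, Tendsto (fun n => ∫ ω, Complex.exp
        ((t * ((∑ k ∈ Finset.range n, centredIncrement (Q (γ (k + 1))) f (X k ω, X (k + 1) ω)) /
          √(partialSum (fun k => εX (γ k)) n : ℝ)) : ℝ) * Complex.I) ∂μ) atTop
      (𝓝 (Real.exp (-(t ^ 2 * (∫ x, Vf x ∂ν) / 2)) : ℝ)) := by
  obtain ⟨Z, hZ, ⟨C, hC, hmom⟩, hvar, -, herg, hLin⟩ := hGC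
  set h : ℕ → ℝ := fun n => (partialSum (fun k => εX (γ k)) n : ℝ) with hh
  set σ := ∫ x, Vf x ∂ν with hσdef
  set D : ℕ → Ω → ℝ := fun k ω => centredIncrement (Q (γ (k + 1))) f (X k ω, X (k + 1) ω) with hDdef
  have hmX := hX.measurable
  have hZm : ∀ k, Measurable (Z (k + 1)) := fun k =>
    (hZ.adapted k).mono (hX.history_le (k + 1)) le_rfl
  set κ : ℕ → Kernel E (ℝ × ℝ) := fun k => incrementKernel μ (Q (γ (k + 1))) f X (Z (k + 1)) k
    with hκ
  have : ∀ k, IsMarkovKernel (κ k) := fun k => by rw [hκ]; infer_instance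
  -- The conditional variance is represented through the kernel and not as `εX * Vf`: this version
  -- is nonnegative everywhere and measurable for the past, whereas `Vf` is not assumed Borel.
  set s : ℕ → Ω → ℝ := fun k ω => ∫ p, p.1 ^ 2 ∂(κ k (X k ω)) with hsdef
  set Lc : ℝ → ℕ → Ω → ℝ := fun e k ω =>
    ∫ p, {x : ℝ | e < |x|}.indicator (fun x => x ^ 2) p.1 ∂(κ k (X k ω)) with hLdef
  have hs0 : ∀ k ω, 0 ≤ s k ω := fun k ω => integral_nonneg fun p => sq_nonneg _
  have hL0 : ∀ e k ω, 0 ≤ Lc e k ω := fun e k ω =>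
    integral_nonneg fun p => Set.indicator_nonneg (fun x _ => sq_nonneg x) _
  have hsm : ∀ k, Measurable[history X k] (s k) := fun k =>
    measurable_integral_kernel_history (κ k) (φ := fun x => x ^ 2) (by fun_prop) k
  have hLm : ∀ e k, Measurable[history X k] (Lc e k) := fun e k =>
    measurable_integral_kernel_history (κ k) (measurable_indicator_sq e) k
  set m : ℕ → Ω → ℝ≥0 := fun k ω => C * εGC (γ (k + 1)) * g (X k ω) with hmdef
  have hmm : ∀ k, Measurable[history X k] fun ω => (m k ω : ℝ) := fun k =>
    ((hg.const_mul (C * εGC (γ (k + 1)))).comp (measurable_history X le_rfl)).coe_nnreal_real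
  have htop : Tendsto h atTop atTop := hw.tendsto_coe
  have hmom' : ∀ k, condLExp (present X k) μ (fun ω => ENNReal.ofReal
      (|D k ω - Z (k + 1) ω| ^ ρ)) ≤ᵐ[μ] fun ω => (m k ω : ℝ≥0∞) := hmom
  have hsV : ∀ᵐ ω ∂μ, Tendsto (fun n => (∑ k ∈ Finset.range n, s k ω) / h n) atTop (𝓝 σ) := by
    have h1 : ∀ k, ∀ᵐ ω ∂μ, s k ω = (εX (γ (k + 1)) : ℝ) * Vf (X k ω) := fun k => by
      filter_upwards [hvar k, hX.condExp_incrementKernel hf k (hZm k) (φ := fun x => x ^ 2)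
        (by fun_prop) (hZ.memLp k).integrable_sq] with ω w1 w2
      rw [← w1]
      exact w2.symm
    filter_upwards [ae_all_iff.2 h1, herg] with ω w1 w2
    refine w2.congr fun n => ?_
    rw [integral_empiricalMeasure_eq_sum_range]
    simp only [w1]
    rfl
  have hσ : 0 ≤ σ := by
    obtain ⟨ω, hω⟩ := hsV.exists
    exact ge_of_tendsto' hω fun n =>
      div_nonneg (Finset.sum_nonneg fun k _ => hs0 k ω) (NNReal.coe_nonneg _)
  refine ⟨hσ, fun t => ?_⟩
  have hsmΩ : ∀ k, Measurable (s k) := fun k => (hsm k).mono (hX.history_le k) le_rfl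
  have hLmΩ : ∀ e k, Measurable (Lc e k) := fun e k => (hLm e k).mono (hX.history_le k) le_rfl
  have hmmΩ : ∀ k, Measurable fun ω => (m k ω : ℝ) := fun k =>
    (hmm k).mono (hX.history_le k) le_rfl
  have hsumm : ∀ᵐ ω ∂μ,
      Tendsto (fun n => (∑ k ∈ Finset.range n, (m k ω : ℝ)) / h n ^ (ρ / 2)) atTop (𝓝 0) := by
    filter_upwards [hSW.tendsto_average hρ hw] with ω hω
    have := hω.const_mul (C : ℝ)
    rw [mul_zero] at this
    refine this.congr fun n => ?_
    rw [← mul_div_assoc, Finset.mul_sum]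
    simp only [hmdef, NNReal.coe_mul, mul_assoc, hh]
  set τ := t ^ 2 * σ / 2 with hτ
  have hτ0 : 0 ≤ τ := by positivity
  set I : ℕ → ℂ := fun n => ∫ ω, Complex.exp
    ((t * ((∑ k ∈ Finset.range n, D k ω) / √(h n)) : ℝ) * Complex.I) ∂μ with hI
  have key : ∀ θ : ℝ, 0 < θ → θ ≤ 1 → ∀ᶠ n in atTop,
      ‖I n - (Real.exp (-τ) : ℝ)‖ ≤ (2 * Real.exp (τ + 1) + (1 + Real.exp (τ + 1))) * θ := by
    intro θ hθ hθ1
    -- One `δ` serves both as the parameter of the Young-type inequality and as the Lindeberg level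
    -- `√(h n) * δ`. The bracket is at most `δ * K` because `δ ≤ 1`. The `+ 1` only keeps the
    -- denominator positive.
    obtain ⟨δ, hδ, hδ1, hδσ⟩ : ∃ δ : ℝ, 0 < δ ∧ δ ≤ 1 ∧
        (δ * t ^ 2 + 4 * (|t| * δ) * t ^ 2 + t ^ 4 * δ ^ 2) * σ ≤ θ / 4 := by
      set K := t ^ 2 + 4 * |t| * t ^ 2 + t ^ 4 with hK
      have hK0 : 0 ≤ K := by positivity
      refine ⟨min 1 (θ / (4 * (K * σ + 1))), by positivity, min_le_left _ _, ?_⟩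
      set δ := min 1 (θ / (4 * (K * σ + 1)))
      have hδ0 : 0 < δ := by positivity
      have h1 : δ ≤ 1 := min_le_left _ _
      have h2 : δ * (4 * (K * σ + 1)) ≤ θ := by
        rw [← le_div_iff₀ (by positivity)]; exact min_le_right _ _
      have h3 : δ * t ^ 2 + 4 * (|t| * δ) * t ^ 2 + t ^ 4 * δ ^ 2 ≤ δ * K := by
        have : t ^ 4 * δ ^ 2 ≤ t ^ 4 * δ := by gcongr; nlinarith
        rw [hK]; linarith
      have h4 := mul_le_mul_of_nonneg_right h3 hσ
      linarith
    set c := δ * t ^ 2 + 4 * (|t| * δ) * t ^ 2 + t ^ 4 * δ ^ 2 with hc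
    have hc0 : 0 ≤ c := by positivity
    set A : ℕ → Ω → ℝ := fun n ω =>
      (3 + 2 / δ) * |t| ^ ρ * ((∑ k ∈ Finset.range n, (m k ω : ℝ)) / h n ^ (ρ / 2)) +
        c * ((∑ k ∈ Finset.range n, s k ω) / h n) with hA
    set T : ℕ → Ω → ℝ := fun n ω => t ^ 2 / 2 * ((∑ k ∈ Finset.range n, s k ω) / h n) with hT
    set L : ℕ → Ω → ℝ := fun n ω =>
      (h n)⁻¹ * ∑ k ∈ Finset.range n, Lc (√(h n) * δ) k ω with hL
    have hAlim : TendstoInMeasure μ A atTop fun _ => c * σ := by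
      refine tendstoInMeasure_of_tendsto_ae (fun n => ?_) ?_
      · exact (by fun_prop : Measurable (A n)).aestronglyMeasurable
      · filter_upwards [hsV, hsumm] with ω w1 w2
        simpa using (w2.const_mul ((3 + 2 / δ) * |t| ^ ρ)).add (w1.const_mul c)
    have hTlim : TendstoInMeasure μ T atTop fun _ => τ := by
      refine tendstoInMeasure_of_tendsto_ae (fun n => ?_) ?_
      · exact (by fun_prop : Measurable (T n)).aestronglyMeasurable
      · filter_upwards [hsV] with ω w1
        have e : τ = t ^ 2 / 2 * σ := by rw [hτ]; ring
        rw [e]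
        exact w1.const_mul _
    have hLlim : TendstoInMeasure μ L atTop fun _ => 0 := by
      refine (hLin δ hδ).congr_left fun n => ?_
      have h1 : ∀ k, ∀ᵐ ω ∂μ, (μ[{ω' | √(h n) * δ < |Z (k + 1) ω'|}.indicator
          (fun ω' => Z (k + 1) ω' ^ 2) | present X k]) ω = Lc (√(h n) * δ) k ω := fun k => by
        have h2 := hX.condExp_incrementKernel hf k (hZm k)
          (measurable_indicator_sq (√(h n) * δ)) (by
            refine ((hZ.memLp k).integrable_sq.indicator
              (measurableSet_lt measurable_const (hZm k).abs :
                MeasurableSet {ω' | √(h n) * δ < |Z (k + 1) ω'|})).congr (ae_of_all _ fun ω => ?_)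
            simp [Set.indicator])
        have h3 : {ω' | √(h n) * δ < |Z (k + 1) ω'|}.indicator (fun ω' => Z (k + 1) ω' ^ 2) =
            fun ω => {x | √(h n) * δ < |x|}.indicator (fun x => x ^ 2) (Z (k + 1) ω) := by
          ext ω
          simp [Set.indicator]
        rw [h3]
        exact h2
      filter_upwards [ae_all_iff.2 h1] with ω w
      simp only [hL]
      congr 1
      exact Finset.sum_congr rfl fun k _ => w k
    have p1 := tendsto_measureReal_of_tendstoInMeasure hAlim (e := θ / 4) (by positivity)
    have p2 := tendsto_measureReal_of_tendstoInMeasure hTlim hθ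
    have p3 := tendsto_measureReal_of_tendstoInMeasure hLlim (e := θ / (2 * (5 * t ^ 2 + 1)))
      (by positivity)
    have p4 := (p1.add p2).add p3
    simp only [add_zero] at p4
    filter_upwards [p4.eventually (Iic_mem_nhds hθ), htop.eventually_gt_atTop 0] with n hn hn0
    -- At this scale `|a|` times the truncation level is `|t| * δ`, independent of `n`. The summed
    -- error is then exactly `A n + 5 * t ^ 2 * L n`.
    set a := t / √(h n) with ha
    have hsq : 0 < √(h n) := Real.sqrt_pos.2 hn0
    have ha2 : a ^ 2 = t ^ 2 / h n := by rw [ha, div_pow, Real.sq_sqrt hn0.le]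
    have haρ : |a| ^ ρ = |t| ^ ρ / h n ^ (ρ / 2) := by
      rw [ha, abs_div, abs_of_pos hsq, Real.div_rpow (abs_nonneg _) hsq.le, Real.sqrt_eq_rpow,
        ← Real.rpow_mul hn0.le]
      congr 2; ring
    have hae : |a| * (√(h n) * δ) = |t| * δ := by
      rw [ha, abs_div, abs_of_pos hsq]; field_simp
    have ha4 : a ^ 4 * (√(h n) * δ) ^ 2 = t ^ 4 * δ ^ 2 / h n := by
      have : a ^ 4 = (a ^ 2) ^ 2 := by ring
      rw [this, ha2, mul_pow, Real.sq_sqrt hn0.le]; field_simp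
    set ξ : ℕ → Ω → ℝ := fun k ω => (3 + 2 / δ) * (|a| ^ ρ * m k ω)
        + (δ * a ^ 2 + 4 * (|a| * (√(h n) * δ)) * a ^ 2 + a ^ 4 * (√(h n) * δ) ^ 2) * s k ω
        + 5 * a ^ 2 * Lc (√(h n) * δ) k ω with hξ
    have hξsum : ∀ ω, ∑ k ∈ Finset.range n, ξ k ω = A n ω + 5 * t ^ 2 * L n ω := fun ω => by
      simp only [hξ, Finset.sum_add_distrib, ← Finset.mul_sum]
      rw [hae, ha4, ha2, haρ, hA, hL, hc]
      field_simp
    have hxsum : ∀ ω, ∑ k ∈ Finset.range n, a ^ 2 * s k ω / 2 = T n ω := fun ω => by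
      rw [← Finset.sum_div, ← Finset.mul_sum, ha2, hT]
      ring
    have hbound := norm_integral_prod_sub_le (μ := μ) (historyFiltration hmX)
      (ζ := fun k ω => Complex.exp ((a * D k ω : ℝ) * Complex.I))
      (x := fun k ω => a ^ 2 * s k ω / 2) (δ := ξ) ?_ ?_ ?_ ?_ ?_ ?_ ?_ hτ0 hθ hθ1 n
    rotate_left
    · intro k
      have h1 : Measurable[history X (k + 1)] (D k) :=
        (measurable_centredIncrement _ hf).comp
          ((measurable_history X k.le_succ).prodMk (measurable_history X le_rfl))
      have h2 : Measurable fun r : ℝ => Complex.exp ((a * r : ℝ) * Complex.I) := by fun_prop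
      exact (h2.comp h1).stronglyMeasurable
    · intro k ω
      rw [Complex.norm_exp_ofReal_mul_I]
    · intro k
      exact ((hsm k).const_mul (a ^ 2)).div_const 2
    · intro k ω
      have := hs0 k ω
      positivity
    · intro k
      exact ((((hmm k).const_mul (|a| ^ ρ)).const_mul (3 + 2 / δ)).add
        ((hsm k).const_mul _)).add ((hLm (√(h n) * δ) k).const_mul _)
    · intro k ω
      have h1 := hs0 k ω
      have h2 := hL0 (√(h n) * δ) k ω
      positivity
    · intro k
      exact hX.norm_condExp_exp_sub_le hf k (hZm k) (hfQ k) (hZ.memLp k) (hZ.centered k) hρ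
        (hmom' k) hδ hδ1 (by positivity) a
    have hIn : I n = ∫ ω, ∏ k ∈ Finset.range n, Complex.exp ((a * D k ω : ℝ) * Complex.I) ∂μ := by
      refine integral_congr_ae (ae_of_all _ fun ω => ?_)
      simp only
      rw [← Complex.exp_sum, ← Finset.sum_mul, ← Complex.ofReal_sum, ← Finset.mul_sum, ha]
      congr 3
      ring
    rw [hIn]
    refine hbound.trans ?_
    -- Outside the three events, `A n < c * σ + θ / 4 ≤ θ / 2` and `5 * t ^ 2 * L n < θ / 2`, so the
    -- total error stays below `θ`.
    have hsub : {ω | θ < |∑ k ∈ Finset.range n, a ^ 2 * s k ω / 2 - τ| ∨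
        θ < ∑ k ∈ Finset.range n, ξ k ω} ⊆ ({ω | θ / 4 ≤ |A n ω - c * σ|} ∪
          {ω | θ ≤ |T n ω - τ|}) ∪ {ω | θ / (2 * (5 * t ^ 2 + 1)) ≤ |L n ω - 0|} := by
      rintro ω (hω | hω)
      · rw [hxsum] at hω
        exact Or.inl (Or.inr hω.le)
      · rw [hξsum] at hω
        by_contra hcon
        have q1 : |A n ω - c * σ| < θ / 4 := not_le.1 fun q => hcon (Or.inl (Or.inl q))
        have q2 : |L n ω - 0| < θ / (2 * (5 * t ^ 2 + 1)) := not_le.1 fun q => hcon (Or.inr q)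
        rw [sub_zero, lt_div_iff₀ (by positivity)] at q2
        have q3 := (abs_lt.1 q1).2
        have q4 : 5 * t ^ 2 * L n ω ≤ |L n ω| * (5 * t ^ 2 + 1) := by
          nlinarith [le_abs_self (L n ω), abs_nonneg (L n ω), sq_nonneg t]
        linarith
    have hmeas : μ.real {ω | θ < |∑ k ∈ Finset.range n, a ^ 2 * s k ω / 2 - τ| ∨
        θ < ∑ k ∈ Finset.range n, ξ k ω} ≤ θ := by
      refine (measureReal_mono hsub).trans (((measureReal_union_le _ _).trans ?_).trans hn)
      gcongr
      exact measureReal_union_le _ _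
    have hB : 0 ≤ 1 + Real.exp (τ + 1) := by positivity
    linarith [mul_le_mul_of_nonneg_left hmeas hB]
  rw [Metric.tendsto_atTop]
  intro ε hε
  set K := 2 * Real.exp (τ + 1) + (1 + Real.exp (τ + 1)) with hK
  have hK0 : 0 < K := by positivity
  obtain ⟨N, hN⟩ := eventually_atTop.1 (key (min 1 (ε / (2 * K))) (by positivity)
    (min_le_left _ _))
  refine ⟨N, fun n hn => ?_⟩
  rw [dist_eq_norm]
  refine (hN n hn).trans_lt ?_
  calc K * min 1 (ε / (2 * K)) ≤ K * (ε / (2 * K)) := by gcongr; exact min_le_right _ _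
    _ = ε / 2 := by field_simp
    _ < ε := by linarith

end CLT

/-! ### Limit theorems for the centred increments -/

section MartingaleLimits

variable {Ω E : Type*} [mΩ : MeasurableSpace Ω] [mE : MeasurableSpace E]
  {μ : Measure Ω} {Q : ℝ≥0 → Kernel E E} {γ : ℕ → ℝ≥0} {X : ℕ → Ω → E}
  [∀ s, IsMarkovKernel (Q s)]

theorem IsMarkovScheme.measurable_increment (hX : IsMarkovScheme μ Q γ X) {f : E → ℝ}
    (hf : Measurable f) (k : ℕ) :
    Measurable fun ω => centredIncrement (Q (γ (k + 1))) f (X k ω, X (k + 1) ω) :=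
  (measurable_centredIncrement _ hf).comp ((hX.measurable k).prodMk (hX.measurable (k + 1)))

variable [IsProbabilityMeasure μ]

/-- Central limit theorem for the centred increments of the scheme. -/
theorem IsMarkovScheme.tendstoInDistribution_sum [MeasurableSingletonClass E]
    (hX : IsMarkovScheme μ Q γ X)
    {f Vf : E → ℝ} (hf : Measurable f) (hfQ : ∀ n x, Integrable f (Q (γ (n + 1)) x))
    {ν : Measure E} {g : E → ℝ≥0} (hg : Measurable g) {ρ : ℝ} (hρ : ρ ∈ Set.Icc (1 : ℝ) 2)
    {εX εGC : ℝ≥0 → ℝ≥0} (hw : IsWeightSequence fun n => εX (γ n))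
    (hGC : GrowthControl μ Q ν γ X g ρ εX εGC f Vf) (hSW : StepWeightCondition μ γ X g ρ εX εGC) :
    TendstoInDistribution (fun (n : ℕ) (ω : Ω) =>
        (∑ k ∈ Finset.range n, centredIncrement (Q (γ (k + 1))) f (X k ω, X (k + 1) ω)) /
          √(partialSum (fun k => εX (γ k)) n : ℝ))
      atTop (id : ℝ → ℝ) (fun _ => μ) (gaussianReal 0 (∫ x, Vf x ∂ν).toNNReal) := by
  have hD := hX.measurable_increment hf
  have hS : ∀ n : ℕ, AEMeasurable (fun ω =>
      (∑ k ∈ Finset.range n, centredIncrement (Q (γ (k + 1))) f (X k ω, X (k + 1) ω)) /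
          √(partialSum (fun k => εX (γ k)) n : ℝ)) μ := fun n =>
    ((Finset.measurable_fun_sum _ fun k _ => hD k).div_const _).aemeasurable
  obtain ⟨hσ, hlim⟩ := hX.tendsto_integral_exp hf hfQ hg hρ hw hGC hSW
  refine ⟨hS, aemeasurable_id, ProbabilityMeasure.tendsto_iff_tendsto_charFun.2 fun t => ?_⟩
  have e : charFun ((gaussianReal 0 (∫ x, Vf x ∂ν).toNNReal).map id) t =
      (Real.exp (-(t ^ 2 * (∫ x, Vf x ∂ν) / 2)) : ℝ) := by
    rw [Measure.map_id, charFun_gaussianReal]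
    push_cast
    rw [Real.coe_toNNReal _ hσ]
    congr 1
    ring
  change Tendsto (fun n => charFun (μ.map _) t) atTop (𝓝 (charFun (Measure.map id _) t))
  rw [e]
  refine (hlim t).congr fun n => ?_
  rw [charFun_apply_real, integral_map (hS n) (by fun_prop)]
  simp only [Complex.ofReal_mul]

/-- When the limit variance vanishes, the normalised sums converge almost surely. -/
theorem IsMarkovScheme.ae_tendsto_sum_zero (hX : IsMarkovScheme μ Q γ X)
    {f Vf : E → ℝ} (hf : Measurable f) (hfQ : ∀ n x, Integrable f (Q (γ (n + 1)) x))
    {ν : Measure E} {g : E → ℝ≥0} (hg : Measurable g) {ρ : ℝ} (hρ : ρ ∈ Set.Icc (1 : ℝ) 2)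
    {εX εGC : ℝ≥0 → ℝ≥0} (hw : IsWeightSequence fun n => εX (γ n))
    (hGC : GrowthControl μ Q ν γ X g ρ εX εGC f Vf) (hSW : StepWeightCondition μ γ X g ρ εX εGC)
    (hV : Vf = 0) :
    ∀ᵐ ω ∂μ, Tendsto (fun n : ℕ =>
        (∑ k ∈ Finset.range n, centredIncrement (Q (γ (k + 1))) f (X k ω, X (k + 1) ω)) /
          √(partialSum (fun k => εX (γ k)) n : ℝ)) atTop (𝓝 0) := by
  classical
  obtain ⟨Z, hZ, ⟨C, hC, hmom⟩, hvar, -, -, -⟩ := hGC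
  set h : ℕ → ℝ≥0 := fun n => partialSum (fun k => εX (γ k)) n with hh
  set D : ℕ → Ω → ℝ := fun k ω => centredIncrement (Q (γ (k + 1))) f (X k ω, X (k + 1) ω) with hDdef
  have hD : ∀ k, Measurable (D k) := hX.measurable_increment hf
  have hρ0 : 0 < ρ := by linarith [hρ.1]
  have hmX := hX.measurable
  -- Zero conditional variance forces `Z` to vanish, so the growth control becomes a bound on the
  -- conditional `ρ`-moment of `D` itself.
  have hZ0 : ∀ k, Z (k + 1) =ᵐ[μ] 0 := fun k => by
    have h1 := (hZ.memLp k).integrable_sq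
    have h2 : ∫ ω, Z (k + 1) ω ^ 2 ∂μ = 0 := by
      rw [← integral_condExp (hmX k).comap_le, integral_congr_ae (hvar k)]
      simp [hV]
    rw [integral_eq_zero_iff_of_nonneg (fun ω => sq_nonneg _) h1] at h2
    filter_upwards [h2] with ω hω
    simpa using hω
  have hφ : ∀ k, Measurable fun p => ENNReal.ofReal
      (|centredIncrement (Q (γ (k + 1))) f p| ^ ρ) := fun k => by
    have := measurable_centredIncrement (Q (γ (k + 1))) hf
    fun_prop
  have hq : ∀ k, ∀ᵐ ω ∂μ, ∫⁻ y, ENNReal.ofReal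
      (|centredIncrement (Q (γ (k + 1))) f (X k ω, y)| ^ ρ) ∂(Q (γ (k + 1)) (X k ω)) ≤
        ((C * εGC (γ (k + 1)) * g (X k ω) : ℝ≥0) : ℝ≥0∞) := fun k => by
    have h1 : (fun ω => ENNReal.ofReal
        (|-(f (X (k + 1) ω) - ∫ y, f y ∂(Q (γ (k + 1)) (X k ω))) - Z (k + 1) ω| ^ ρ)) =ᵐ[μ]
        fun ω => ENNReal.ofReal (|D k ω| ^ ρ) := by
      filter_upwards [hZ0 k] with ω hω
      rw [hω]
      simp [hDdef, centredIncrement]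
    filter_upwards [hX.condLExp_pair k (hφ k), hmom k, condLExp_congr_ae (mΩ := present X k) h1]
      with ω w1 w2 w3
    rw [w3] at w2
    rw [← w1]
    exact w2
  -- `c k` bounds the conditional `ρ`-moment of `D k / √(h (k + 1))`, and its sum over `k` is finite
  -- by the step-weight condition. Where `h (k + 1) = 0`, all these quotients are zero.
  set c : ℕ → Ω → ℝ≥0 := fun k ω => C * εGC (γ (k + 1)) * g (X k ω) / h (k + 1) ^ (ρ / 2) with hc
  have hcm : ∀ k, Measurable[history X k] (c k) := fun k =>
    ((hg.const_mul (C * εGC (γ (k + 1)))).comp (measurable_history X le_rfl)).div_const _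
  -- The sum of the `c k` is finite almost surely but need not be integrable, hence this predictable
  -- localisation. For almost every `ω` some `N` puts `ω` in every `A N k`.
  let A : ℕ → ℕ → Set Ω := fun N k => {ω | ∑ j ∈ Finset.range (k + 1), (c j ω : ℝ) ≤ N}
  have hA : ∀ N k, MeasurableSet[history X k] (A N k) := fun N k => by
    have h1 : Measurable[history X k] fun ω => ∑ j ∈ Finset.range (k + 1), (c j ω : ℝ) :=
      Finset.measurable_fun_sum _ fun j hj =>
        ((hcm j).mono ((historyFiltration hmX).mono (Finset.mem_range_succ_iff.1 hj))
          le_rfl).coe_nnreal_real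
    exact @measurableSet_le _ _ _ _ _ (history X k) _ _ _ _ _ h1 measurable_const
  have hAΩ : ∀ N k, MeasurableSet (A N k) := fun N k => hX.history_le k _ (hA N k)
  have hconv : ∀ N : ℕ, ∀ᵐ ω ∂μ, ∃ l, Tendsto (fun n => ∑ k ∈ Finset.range n,
      (A N k).indicator (fun ω => D k ω / √(h (k + 1) : ℝ)) ω) atTop (𝓝 l) := by
    intro N
    set y : ℕ → Ω → ℝ := fun k => (A N k).indicator (fun ω => D k ω / √(h (k + 1) : ℝ)) with hy
    have hym : ∀ k, Measurable[history X (k + 1)] (y k) := fun k => by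
      have h1 : Measurable[history X (k + 1)] (D k) :=
        (measurable_centredIncrement _ hf).comp
          ((measurable_history X k.le_succ).prodMk (measurable_history X le_rfl))
      exact (h1.div_const _).indicator ((historyFiltration hmX).mono k.le_succ _ (hA N k))
    have hymΩ : ∀ k, Measurable (y k) := fun k => (hym k).mono (hX.history_le _) le_rfl
    have hcint : ∀ k, Integrable (fun ω => if ω ∈ A N k then (c k ω : ℝ) else 0) μ := by
      intro k
      refine Integrable.of_bound (C := N) ?_ (ae_of_all _ fun ω => ?_)
      · exact (Measurable.ite (hAΩ N k) ((hcm k).mono (hX.history_le k) le_rfl).coe_nnreal_real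
          measurable_const).aestronglyMeasurable
      · split_ifs with hω
        · rw [Real.norm_of_nonneg (NNReal.coe_nonneg _)]
          exact (Finset.single_le_sum (f := fun j => (c j ω : ℝ))
            (fun j _ => NNReal.coe_nonneg _) (Finset.self_mem_range_succ k)).trans hω
        · simp
    have hyle : ∀ k, ∫⁻ ω, ENNReal.ofReal (|y k ω| ^ ρ) ∂μ ≤
        ∫⁻ ω, ENNReal.ofReal (if ω ∈ A N k then (c k ω : ℝ) else 0) ∂μ := by
      intro k
      set K : ℝ≥0 := (h (k + 1) ^ (ρ / 2))⁻¹ with hK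
      have hyk : ∀ ω, y k ω = (A N k).indicator (fun ω => D k ω / √(h (k + 1) : ℝ)) ω :=
        fun _ => rfl
      have hck : ∀ ω, c k ω = K * (C * εGC (γ (k + 1)) * g (X k ω)) :=
        fun _ => div_eq_inv_mul _ _
      have e1 : ∀ ω, ENNReal.ofReal (|y k ω| ^ ρ) =
          (A N k).indicator (fun ω => (K : ℝ≥0∞) * ENNReal.ofReal (|D k ω| ^ ρ)) ω := fun ω => by
        by_cases hω : ω ∈ A N k
        · have e3 : √(h (k + 1) : ℝ) ^ ρ = ((h (k + 1) ^ (ρ / 2) : ℝ≥0) : ℝ) := by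
            rw [Real.sqrt_eq_rpow, ← Real.rpow_mul (NNReal.coe_nonneg _), NNReal.coe_rpow]
            congr 1; ring
          rw [hyk, Set.indicator_of_mem hω, Set.indicator_of_mem hω, abs_div,
            abs_of_nonneg (Real.sqrt_nonneg _), Real.div_rpow (abs_nonneg _) (Real.sqrt_nonneg _),
            e3, div_eq_inv_mul (|D k ω| ^ ρ), ENNReal.ofReal_mul (by positivity), ← NNReal.coe_inv,
            ENNReal.ofReal_coe_nnreal]
        · rw [hyk, Set.indicator_of_notMem hω, Set.indicator_of_notMem hω, abs_zero,
            Real.zero_rpow hρ0.ne', ENNReal.ofReal_zero]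
      have e2 : ∀ ω, ENNReal.ofReal (if ω ∈ A N k then (c k ω : ℝ) else 0) =
          (A N k).indicator (fun ω => (K : ℝ≥0∞) *
            ((C * εGC (γ (k + 1)) * g (X k ω) : ℝ≥0) : ℝ≥0∞)) ω := fun ω => by
        by_cases hω : ω ∈ A N k
        · rw [Set.indicator_of_mem hω, if_pos hω, ENNReal.ofReal_coe_nnreal, hck,
            ENNReal.coe_mul]
        · rw [Set.indicator_of_notMem hω, if_neg hω, ENNReal.ofReal_zero]
      simp_rw [e1, e2]
      rw [lintegral_indicator (hAΩ N k), lintegral_indicator (hAΩ N k),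
        lintegral_const_mul' _ _ ENNReal.coe_ne_top, lintegral_const_mul' _ _ ENNReal.coe_ne_top]
      gcongr 1
      calc ∫⁻ ω in A N k, ENNReal.ofReal (|D k ω| ^ ρ) ∂μ
          = ∫⁻ ω in A N k, ∫⁻ y, ENNReal.ofReal
              (|centredIncrement (Q (γ (k + 1))) f (X k ω, y)| ^ ρ)
                ∂(Q (γ (k + 1)) (X k ω)) ∂μ := hX.setLIntegral_pair k (hA N k) (hφ k)
        _ ≤ _ := lintegral_mono_ae (ae_restrict_of_ae (hq k))
    have hyρ : ∀ k, Integrable (fun ω => |y k ω| ^ ρ) μ ∧ ∫ ω, |y k ω| ^ ρ ∂μ ≤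
        ∫ ω, (if ω ∈ A N k then (c k ω : ℝ) else 0) ∂μ := by
      intro k
      have h0 : ∀ ω, 0 ≤ |y k ω| ^ ρ := fun ω => Real.rpow_nonneg (abs_nonneg _) _
      have h1 : ∀ ω, 0 ≤ (if ω ∈ A N k then (c k ω : ℝ) else 0) := fun ω => by
        split_ifs
        · exact NNReal.coe_nonneg _
        · exact le_rfl
      have hm : Measurable fun ω => |y k ω| ^ ρ := by
        have := hymΩ k
        fun_prop
      have h2 := hyle k
      rw [← ofReal_integral_eq_lintegral_ofReal (hcint k) (ae_of_all _ h1)] at h2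
      refine ⟨⟨hm.aestronglyMeasurable, ?_⟩, ?_⟩
      · rw [hasFiniteIntegral_iff_ofReal (ae_of_all _ h0)]
        exact h2.trans_lt ENNReal.ofReal_lt_top
      · rw [integral_eq_lintegral_of_nonneg_ae (ae_of_all _ h0) hm.aestronglyMeasurable]
        exact ENNReal.toReal_le_of_le_ofReal (integral_nonneg h1) h2
    have hyi : ∀ k, Integrable (y k) μ := fun k => by
      refine Integrable.mono' (g := fun ω => 1 + |y k ω| ^ ρ) ((integrable_const 1).add (hyρ k).1)
        (hymΩ k).aestronglyMeasurable (ae_of_all _ fun ω => ?_)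
      rw [Real.norm_eq_abs]
      have h0 : 0 ≤ |y k ω| ^ ρ := Real.rpow_nonneg (abs_nonneg _) _
      rcases le_total |y k ω| 1 with h1 | h1
      · linarith
      · have : |y k ω| ≤ |y k ω| ^ ρ := by
          simpa using Real.rpow_le_rpow_of_exponent_le h1 hρ.1
        linarith
    refine ae_exists_tendsto_sum_of_bdd_moment (historyFiltration hmX)
      (fun k => (hym k).stronglyMeasurable) hyi ?_ hρ (fun k => (hyρ k).1) (C := N) ?_
    · intro k
      -- `D k` need not be integrable on all of `Ω`. It is integrable on `A N k` after
      -- normalisation, so centring is checked by the joint law restricted to events of the past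
      -- inside `A N k`.
      refine (ae_eq_condExp_of_forall_setIntegral_eq (hX.history_le k) (hyi k)
        (fun _ _ _ => integrableOn_zero) (fun B hB _ => ?_)
        stronglyMeasurable_const.aestronglyMeasurable).symm
      have hBA := MeasurableSet.inter (m := history X k) hB (hA N k)
      have h1 : IntegrableOn (fun ω => D k ω / √(h (k + 1) : ℝ)) (B ∩ A N k) μ := by
        have := (hyi k).integrableOn (s := B)
        rw [hy, IntegrableOn, integrable_indicator_iff (hAΩ N k), IntegrableOn,
          Measure.restrict_restrict (hAΩ N k), Set.inter_comm] at this
        exact this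
      have h2 := (hX.setIntegral_pair k hBA
        (φ := fun p => centredIncrement (Q (γ (k + 1))) f p / √(h (k + 1) : ℝ))
        ((measurable_centredIncrement _ hf).div_const _).stronglyMeasurable h1).2
      rw [hy, setIntegral_indicator (hAΩ N k)]
      simp only [integral_div, integral_centredIncrement (hfQ k _)] at h2
      rw [integral_div]
      simpa using h2.symm
    · intro n
      calc ∑ k ∈ Finset.range n, ∫ ω, |y k ω| ^ ρ ∂μ
          ≤ ∑ k ∈ Finset.range n, ∫ ω, (if ω ∈ A N k then (c k ω : ℝ) else 0) ∂μ :=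
            Finset.sum_le_sum fun k _ => (hyρ k).2
        _ = ∫ ω, ∑ k ∈ Finset.range n, (if ω ∈ A N k then (c k ω : ℝ) else 0) ∂μ :=
            (integral_finsetSum _ fun k _ => hcint k).symm
        _ ≤ ∫ _, (N : ℝ) ∂μ := by
            refine integral_mono (integrable_finsetSum _ fun k _ => hcint k)
              (integrable_const _) fun ω => ?_
            exact sum_ite_le_of_forall_imp (p := fun k => ω ∈ A N k)
              (fun j => NNReal.coe_nonneg _) (Nat.cast_nonneg N) (fun j hj => hj) n
        _ = N := by simp
  filter_upwards [ae_all_iff.2 hconv, hSW] with ω w1 w2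
  have hcs : Summable fun k => (c k ω : ℝ) := by
    refine (w2.mul_left (C : ℝ)).congr fun k => ?_
    simp only [hc, hh, NNReal.coe_div, NNReal.coe_mul, NNReal.coe_rpow]
    ring
  obtain ⟨N, hN⟩ := exists_nat_ge (∑' k, (c k ω : ℝ))
  have hmem : ∀ k, ω ∈ A N k := fun k =>
    (hcs.sum_le_tsum _ fun j _ => NNReal.coe_nonneg _).trans hN
  obtain ⟨l, hl⟩ := w1 N
  refine tendsto_sum_div_of_tendsto_sum_div (b := fun n => √(h n : ℝ)) (c := l) ?_ ?_ ?_ ?_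
  · simp [hh, partialSum]
  · exact fun i j hij => Real.sqrt_le_sqrt (NNReal.coe_le_coe.2 (monotone_partialSum _ hij))
  · exact Real.tendsto_sqrt_atTop.comp hw.tendsto_coe
  · refine hl.congr fun n => Finset.sum_congr rfl fun k _ => ?_
    rw [Set.indicator_of_mem (hmem k)]

end MartingaleLimits

/-! ### Averages of the weak-error bound along the chain -/

section WeakErrorRemainder

variable {Ω E Ω' : Type*} [MeasurableSpace Ω] [MetricSpace E] [MeasurableSpace E]
  [MeasurableSpace Ω']

theorem IsStepSequence.mem_Ioc {γ : ℕ → ℝ≥0} (hγ : IsStepSequence γ) (k : ℕ) :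
    γ (k + 1) ∈ Set.Ioc 0 (supStep γ) := by
  have hb : BddAbove (Set.range γ) := hγ.tendsto_zero.bddAbove_range
  exact ⟨hγ.pos _ (by omega), le_ciSup (f := fun n => γ (n + 1))
    (hb.mono (by rintro _ ⟨n, rfl⟩; exact ⟨n + 1, rfl⟩)) k⟩

theorem IsStepSequence.tendsto_succ {γ : ℕ → ℝ≥0} (hγ : IsStepSequence γ) :
    Tendsto (fun k => γ (k + 1)) atTop (𝓝[>] 0) :=
  tendsto_nhdsWithin_iff.2 ⟨hγ.tendsto_zero.comp (tendsto_add_atTop_nat 1),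
    Eventually.of_forall fun k => hγ.pos _ (by omega)⟩

/-- Under the first alternative the error density is uniformly small for small steps. -/
theorem LocalErrorCondition.ae_tendsto {P' : Measure Ω'} {γbar : ℝ≥0} {L : E → ℝ≥0 → Ω' → ℝ≥0}
    (hL : LocalErrorCondition P' γbar L) {s : ℕ → ℝ≥0} (hs : Tendsto s atTop (𝓝[>] 0))
    (x : ℕ → E) : ∀ᵐ ω' ∂P', Tendsto (fun k => (L (x k) (s k) ω' : ℝ)) atTop (𝓝 0) := by
  obtain ⟨γlow, -, hlow, hae⟩ := hL
  filter_upwards [hae] with ω' hω'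
  -- The states `x k` may wander arbitrarily. Outside a compact `K` the density is small for every
  -- step in `(0, γlow ω']`, and inside `K` it is small once the step is small.
  have key : Tendsto (fun k => (L (x k) (s k) ω' : ℝ≥0∞)) atTop (𝓝 0) := by
    rw [ENNReal.tendsto_nhds_zero]
    intro e he
    have h1 := (ENNReal.tendsto_nhds_zero.1 hω'.2) e he
    obtain ⟨K, hK, hKe⟩ := mem_cocompact.1 h1
    have h2 := hs.eventually ((ENNReal.tendsto_nhds_zero.1 (hω'.1 K hK)) e he)
    have h3 : ∀ᶠ k in atTop, s k ∈ Set.Ioc 0 (γlow ω') :=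
      hs.eventually (Ioc_mem_nhdsGT (hlow ω').1)
    filter_upwards [h2, h3] with k h2 h3
    by_cases hx : x k ∈ K
    · exact (le_iSup₂ (f := fun y (_ : y ∈ K) => (L y (s k) ω' : ℝ≥0∞)) (x k) hx).trans h2
    · exact (le_iSup₂ (f := fun t (_ : t ∈ Set.Ioc 0 (γlow ω')) => (L (x k) t ω' : ℝ≥0∞))
        (s k) h3).trans (hKe hx)
  have := (ENNReal.tendsto_toReal ENNReal.zero_ne_top).comp key
  simpa [Function.comp_def] using this

theorem UniformErrorCondition.ae_tendsto {P' : Measure Ω'} {g : E → ℝ≥0}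
    {L : E → ℝ≥0 → Ω' → ℝ≥0} (hL : UniformErrorCondition P' g L) {s : ℕ → ℝ≥0}
    (hs : Tendsto s atTop (𝓝[>] 0)) (x : ℕ → E) :
    ∀ᵐ ω' ∂P', Tendsto (fun k => (g (x k) : ℝ) * (L (x k) (s k) ω' : ℝ)) atTop (𝓝 0) := by
  filter_upwards [hL] with ω' hω'
  have key : Tendsto (fun k => ((L (x k) (s k) ω' * g (x k) : ℝ≥0) : ℝ≥0∞)) atTop (𝓝 0) :=
    tendsto_of_tendsto_of_tendsto_of_le_of_le tendsto_const_nhds (hω'.comp hs)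
      (fun _ => zero_le) fun k =>
        le_iSup (fun y => ((L y (s k) ω' * g y : ℝ≥0) : ℝ≥0∞)) (x k)
  have := (ENNReal.tendsto_toReal ENNReal.zero_ne_top).comp key
  simpa [Function.comp_def, mul_comm] using this

/-- Averages of one term of the error bound along a sequence of states. -/
theorem tendsto_weighted_error {P' : Measure Ω'} [IsProbabilityMeasure P'] {γ : ℕ → ℝ≥0}
    (hγ : IsStepSequence γ) {L : E → ℝ≥0 → Ω' → ℝ≥0}
    (hLm : Measurable fun z : E × ℝ≥0 × Ω' => L z.1 z.2.1 z.2.2) {g : E → ℝ≥0}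
    (hdom : ∫⁻ ω', (⨆ x : E, ⨆ s ∈ Set.Ioc 0 (supStep γ), (L x s ω' : ℝ≥0∞)) ∂P' < ∞)
    (halt : LocalErrorCondition P' (supStep γ) L ∨ UniformErrorCondition P' g L)
    {w : ℕ → ℝ≥0} (hw : IsWeightSequence w) (x : ℕ → E) {C : ℝ}
    (hC : ∀ n, 1 ≤ n →
      (∑ k ∈ Finset.range n, (w (k + 1) : ℝ) * g (x k)) / (partialSum w n : ℝ) ≤ C) :
    Tendsto (fun n => (∑ k ∈ Finset.range n, (w (k + 1) : ℝ) *
      (g (x k) * ∫ ω', (L (x k) (γ (k + 1)) ω' : ℝ) ∂P')) / (partialSum w n : ℝ))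
      atTop (𝓝 0) := by
  set ℓ : ℕ → Ω' → ℝ≥0 := fun k ω' => L (x k) (γ (k + 1)) ω' with hℓ
  have hℓm : ∀ k, Measurable (ℓ k) := fun k =>
    hLm.comp (measurable_const.prodMk (measurable_const.prodMk measurable_id))
  -- The supremum along the trajectory is countable, hence measurable, and it is bounded by the
  -- integrable supremum over all states and steps.
  set G : Ω' → ℝ≥0∞ := fun ω' => ⨆ k, (ℓ k ω' : ℝ≥0∞) with hG
  have hGm : Measurable G := Measurable.iSup fun k => (hℓm k).coe_nnreal_ennreal
  have hGi : ∫⁻ ω', G ω' ∂P' ≠ ∞ := by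
    refine (lt_of_le_of_lt (lintegral_mono fun ω' => iSup_le fun k => ?_) hdom).ne
    exact (le_iSup₂ (f := fun s (_ : s ∈ Set.Ioc 0 (supStep γ)) => (L (x k) s ω' : ℝ≥0∞))
      (γ (k + 1)) (hγ.mem_Ioc k)).trans
      (le_iSup (fun y => ⨆ s ∈ Set.Ioc 0 (supStep γ), (L y s ω' : ℝ≥0∞)) (x k))
  have hGint : Integrable (fun ω' => (G ω').toReal) P' :=
    integrable_toReal_of_lintegral_ne_top hGm.aemeasurable hGi
  have hle : ∀ᵐ ω' ∂P', ∀ k, (ℓ k ω' : ℝ) ≤ (G ω').toReal := by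
    filter_upwards [ae_lt_top hGm hGi] with ω' hω' k
    have := ENNReal.toReal_mono hω'.ne (le_iSup (fun k => (ℓ k ω' : ℝ≥0∞)) k)
    simpa using this
  have hℓi : ∀ k, Integrable (fun ω' => (ℓ k ω' : ℝ)) P' := fun k =>
    hGint.mono' (hℓm k).coe_nnreal_real.aestronglyMeasurable (by
      filter_upwards [hle] with ω' hω'
      simpa using hω' k)
  set t : ℕ → ℝ := fun n => (partialSum w n : ℝ) with ht
  have hts : ∀ n, ∑ k ∈ Finset.range n, (w (k + 1) : ℝ) = t n := fun n => (coe_partialSum w n).symm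
  have htop : Tendsto t atTop atTop := hw.tendsto_coe
  have hp : ∀ᶠ n in atTop, ∑ k ∈ Finset.range n, (w (k + 1) : ℝ) * g (x k) ≤
      C * ∑ k ∈ Finset.range n, (w (k + 1) : ℝ) := by
    filter_upwards [htop.eventually_gt_atTop 0, eventually_ge_atTop 1] with n hn hn1
    rw [hts, ← div_le_iff₀ hn]
    exact hC n hn1
  set F : ℕ → Ω' → ℝ := fun n ω' =>
    (∑ k ∈ Finset.range n, (w (k + 1) : ℝ) * g (x k) * ℓ k ω') / t n with hF
  -- Under the first alternative `L → 0` and the weights are `w * g`, whose averages are bounded.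
  -- Under the second, `g * L → 0` directly and the weights are `w`.
  have hlim : ∀ᵐ ω' ∂P', Tendsto (fun n => F n ω') atTop (𝓝 0) := by
    rcases halt with h | h
    · filter_upwards [h.ae_tendsto hγ.tendsto_succ x] with ω' hω'
      have := tendsto_weighted_sum_div (p := fun k => (w (k + 1) : ℝ) * g (x k))
        (w := fun k => (w (k + 1) : ℝ)) (fun k => by positivity) (fun k => by positivity)
        (by simpa only [hts] using htop) hp hω'
      simpa only [hts] using this
    · filter_upwards [h.ae_tendsto hγ.tendsto_succ x] with ω' hω'
      have := tendsto_weighted_sum_div (p := fun k => (w (k + 1) : ℝ))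
        (w := fun k => (w (k + 1) : ℝ)) (C := 1) (fun k => by positivity) (fun k => by positivity)
        (by simpa only [hts] using htop) (Eventually.of_forall fun n => by rw [one_mul]) hω'
      simpa only [hts, ← mul_assoc] using this
  have hFm : ∀ n, Measurable (F n) := fun n => by
    have := fun k => (hℓm k).coe_nnreal_real
    fun_prop
  have hdct := tendsto_integral_filter_of_dominated_convergence (μ := P') (F := F) (l := atTop)
    (f := fun _ => 0) (fun ω' => C * (G ω').toReal)
    (Eventually.of_forall fun n => (hFm n).aestronglyMeasurable)
    (by
      filter_upwards [eventually_ge_atTop 1] with n hn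
      filter_upwards [hle] with ω' hω'
      have h0 : 0 ≤ F n ω' :=
        div_nonneg (Finset.sum_nonneg fun k _ => by positivity) (NNReal.coe_nonneg _)
      rw [Real.norm_of_nonneg h0]
      calc F n ω' ≤ (∑ k ∈ Finset.range n, (w (k + 1) : ℝ) * g (x k) * (G ω').toReal) / t n := by
            refine div_le_div_of_nonneg_right (Finset.sum_le_sum fun k _ => ?_)
              (NNReal.coe_nonneg _)
            exact mul_le_mul_of_nonneg_left (hω' k) (by positivity)
        _ = (∑ k ∈ Finset.range n, (w (k + 1) : ℝ) * g (x k)) / t n * (G ω').toReal := by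
            rw [← Finset.sum_mul]; ring
        _ ≤ C * (G ω').toReal := mul_le_mul_of_nonneg_right (hC n hn) ENNReal.toReal_nonneg)
    (hGint.const_mul C) hlim
  simp only [integral_zero] at hdct
  refine hdct.congr fun n => ?_
  rw [integral_div, integral_finsetSum _ fun k _ => (hℓi k).const_mul _]
  simp only [integral_const_mul, mul_assoc, ht, hℓ]

/-- The error bound of the weak expansion is negligible along the chain. -/
theorem IsErrorRepresentation.ae_tendsto [BorelSpace E] {μ : Measure Ω} {P' : Measure Ω'}
    [IsProbabilityMeasure P'] {γ : ℕ → ℝ≥0} (hγ : IsStepSequence γ) {X : ℕ → Ω → E}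
    {ηt : ℝ≥0 → ℝ≥0} (hw : IsWeightSequence fun n => ηt (γ n)) {Λ : E → ℝ≥0 → ℝ≥0} {l : ℕ}
    {g : E → Fin l → ℝ≥0} {L : E → ℝ≥0 → Ω' → Fin l → ℝ≥0}
    (h : IsErrorRepresentation μ P' γ X ηt Λ g L) :
    ∀ᵐ ω ∂μ, Tendsto (fun n => (∑ k ∈ Finset.range n,
      (ηt (γ (k + 1)) : ℝ) * (Λ (X k ω) (γ (k + 1)) : ℝ)) /
        (partialSum (fun k => ηt (γ k)) n : ℝ)) atTop (𝓝 0) := by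
  filter_upwards [ae_all_iff.2 h.empirical_bound] with ω hω
  have hi : ∀ i, Tendsto (fun n => (∑ k ∈ Finset.range n, (ηt (γ (k + 1)) : ℝ) *
      (g (X k ω) i * ∫ ω', (L (X k ω) (γ (k + 1)) ω' i : ℝ) ∂P')) /
        (partialSum (fun k => ηt (γ k)) n : ℝ)) atTop (𝓝 0) := fun i => by
    obtain ⟨C, hC⟩ := hω i
    refine tendsto_weighted_error hγ (L := fun x s ω' => L x s ω' i) (g := fun x => g x i)
      ((measurable_pi_apply i).comp h.measurable_L) (h.dominated i) (h.alternative i) hw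
      (fun k => X k ω) (C := C) fun n hn => ?_
    have := hC n hn
    rwa [integral_empiricalMeasure_eq_sum_range] at this
  have hsum := tendsto_finsetSum Finset.univ fun i _ => hi i
  simp only [Finset.sum_const_zero] at hsum
  refine hsum.congr fun n => ?_
  rw [← Finset.sum_div, Finset.sum_comm]
  congr 1
  refine Finset.sum_congr rfl fun k _ => ?_
  rw [h.eq_pairing _ _ (hγ.mem_Ioc k), Finset.mul_sum]

end WeakErrorRemainder

/-! ### Convergence in distribution -/

section Distribution

variable {Ω Ω₁ Ω₂ : Type*} [MeasurableSpace Ω] [MeasurableSpace Ω₁] [MeasurableSpace Ω₂]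
  {μ : Measure Ω} [IsProbabilityMeasure μ] {μ₁ : Measure Ω₁} [IsProbabilityMeasure μ₁]
  {μ₂ : Measure Ω₂} [IsProbabilityMeasure μ₂]

/-- Convergence in distribution depends on the limit only through its law. -/
theorem tendstoInDistribution_of_map_eq {Y : ℕ → Ω → ℝ} {Z₁ : Ω₁ → ℝ} {Z₂ : Ω₂ → ℝ}
    (h : TendstoInDistribution Y atTop Z₁ (fun _ => μ) μ₁) (hZ : AEMeasurable Z₂ μ₂)
    (hmap : μ₁.map Z₁ = μ₂.map Z₂) :
    TendstoInDistribution Y atTop Z₂ (fun _ => μ) μ₂ where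
  forall_aemeasurable := h.forall_aemeasurable
  aemeasurable_limit := hZ
  tendsto := by
    have h1 := h.tendsto
    simp only [hmap] at h1
    exact h1

/-- Convergence in distribution to a constant implies convergence in probability. -/
theorem tendstoInMeasure_of_tendstoInDistribution_const {Y : ℕ → Ω → ℝ} {c : ℝ}
    (h : TendstoInDistribution Y atTop (fun _ => c) (fun _ => μ) μ₁) :
    TendstoInMeasure μ Y atTop fun _ => c := by
  rw [tendstoInMeasure_iff_norm]
  intro e he
  have hF : IsClosed {x : ℝ | e ≤ ‖x - c‖} := isClosed_le continuous_const (by fun_prop)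
  have h1 := ProbabilityMeasure.limsup_measure_closed_le_of_tendsto h.tendsto hF
  have h2 : (μ₁.map fun _ => c) {x : ℝ | e ≤ ‖x - c‖} = 0 := by
    rw [Measure.map_apply measurable_const hF.measurableSet]
    simp [not_le.2 he]
  have h3 : ∀ n, (μ.map (Y n)) {x : ℝ | e ≤ ‖x - c‖} = μ {ω | e ≤ ‖Y n ω - c‖} := fun n =>
    Measure.map_apply_of_aemeasurable (h.forall_aemeasurable n) hF.measurableSet
  simp only [ProbabilityMeasure.coe_mk, h2, h3] at h1
  exact tendsto_of_le_liminf_of_limsup_le zero_le h1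

end Distribution

/-! ### Decomposition of the weighted sums of the generator -/

section Decomposition

variable {Ω E Ω' : Type*} [MeasurableSpace E]

theorem partialSum_mul_integral_empiricalMeasure [MeasurableSingletonClass E] (w : ℕ → ℝ≥0)
    (X : ℕ → Ω → E) (n : ℕ) (ω : Ω) (f : E → ℝ) :
    (partialSum w n : ℝ) * ∫ x, f x ∂(empiricalMeasure w X n ω) =
      ∑ k ∈ Finset.range n, (w (k + 1) : ℝ) * f (X k ω) := by
  rw [integral_empiricalMeasure_eq_sum_range]
  rcases eq_or_ne (partialSum w n : ℝ) 0 with h | h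
  · rw [h, zero_mul]
    rw [coe_partialSum, Finset.sum_eq_zero_iff_of_nonneg fun k _ => NNReal.coe_nonneg _] at h
    exact (Finset.sum_eq_zero fun k hk => by rw [h k hk, zero_mul]).symm
  · rw [mul_div_cancel₀ _ h]

theorem partialSum_div_mul_integral_generator [MetricSpace E] [MeasurableSingletonClass E]
    {P : ℝ≥0 → Kernel E E}
    {γ η : ℕ → ℝ≥0} {C : ℝ≥0} (hC : 0 < C) (hη : ∀ n, 1 ≤ n → η n = C * γ n)
    (X : ℕ → Ω → E) (f : E → ℝ) (n : ℕ) (ω : Ω) (s : ℝ) :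
    (partialSum η n : ℝ) / ((C : ℝ) * s) * ∫ x, generator P f x ∂(empiricalMeasure η X n ω) =
      (∑ k ∈ Finset.range n, (γ (k + 1) : ℝ) * generator P f (X k ω)) / s := by
  have hC' : (C : ℝ) ≠ 0 := by exact_mod_cast hC.ne'
  rw [div_mul_eq_mul_div, partialSum_mul_integral_empiricalMeasure, ← mul_div_mul_left _ s hC',
    Finset.mul_sum]
  congr 1
  refine Finset.sum_congr rfl fun k _ => ?_
  rw [hη _ (by omega), NNReal.coe_mul, mul_assoc]

/-- In each step `γ A f = (Q f - f) - remainder`, and `Q f(x_k) - f(x_k)` is the centred increment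
plus `f(x_{k+1}) - f(x_k)`, which telescopes. -/
theorem sum_generator_eq [MetricSpace E] (P Q : ℝ≥0 → Kernel E E) {γ : ℕ → ℝ≥0} (hγ : IsStepSequence γ)
    (f : E → ℝ) (x : ℕ → E) (n : ℕ) :
    ∑ k ∈ Finset.range n, (γ (k + 1) : ℝ) * generator P f (x k) =
      ∑ k ∈ Finset.range n, centredIncrement (Q (γ (k + 1))) f (x k, x (k + 1)) +
        (f (x n) - f (x 0)) + ∑ k ∈ Finset.range n, -remainder P Q f (x k) (γ (k + 1)) := by
  rw [← Finset.sum_range_sub (fun k => f (x k)), ← Finset.sum_add_distrib,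
    ← Finset.sum_add_distrib]
  refine Finset.sum_congr rfl fun k _ => ?_
  have h0 : (γ (k + 1) : ℝ) ≠ 0 := by exact_mod_cast (hγ.pos (k + 1) (by omega)).ne'
  rw [remainder, pseudoGenerator, mul_div_cancel₀ _ h0, centredIncrement]
  ring

/-- The weighted sums of the first-order remainder. -/
theorem WeakErrorExpansion.ae_tendsto [MeasurableSpace Ω] [MeasurableSpace Ω'] [MetricSpace E]
    [BorelSpace E] {μ : Measure Ω} {P' : Measure Ω'}
    [IsProbabilityMeasure P'] {P Q : ℝ≥0 → Kernel E E} {ν : Measure E} {γ : ℕ → ℝ≥0}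
    (hγ : IsStepSequence γ) {X : ℕ → Ω → E} {ηt : ℝ≥0 → ℝ≥0}
    (hw : IsWeightSequence fun n => ηt (γ n)) {f Mf : E → ℝ}
    (h : WeakErrorExpansion μ P' P Q ν γ X ηt f Mf) :
    ∀ᵐ ω ∂μ, Tendsto (fun n => (∑ k ∈ Finset.range n, -remainder P Q f (X k ω) (γ (k + 1))) /
      (partialSum (fun k => ηt (γ k)) n : ℝ)) atTop (𝓝 (∫ x, Mf x ∂ν)) := by
  obtain ⟨Λ, l, g, L, hL, hle⟩ := h.expansion
  filter_upwards [h.ergodic_M, hL.ae_tendsto hγ hw] with ω h1 h2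
  simp only [integral_empiricalMeasure_eq_sum_range] at h1
  rw [← add_zero (∫ x, Mf x ∂ν)]
  refine (h1.add (squeeze_zero_norm (f := fun n => (∑ k ∈ Finset.range n,
    (-remainder P Q f (X k ω) (γ (k + 1)) - (ηt (γ (k + 1)) : ℝ) * Mf (X k ω))) /
      (partialSum (fun k => ηt (γ k)) n : ℝ)) (fun n => ?_) h2)).congr fun n => ?_
  · rw [norm_div, Real.norm_of_nonneg (NNReal.coe_nonneg _)]
    refine div_le_div_of_nonneg_right ((norm_sum_le _ _).trans (Finset.sum_le_sum fun k _ => ?_))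
      (NNReal.coe_nonneg _)
    have := hle (X k ω) _ (hγ.mem_Ioc k)
    rwa [neg_one_mul] at this
  · rw [← add_div, ← Finset.sum_add_distrib]
    simp

end Decomposition

/-! ### Negligibility of the endpoint -/

section Endpoint

variable {Ω E : Type*} [MeasurableSpace Ω] {μ : Measure Ω} {γ : ℕ → ℝ≥0} {X : ℕ → Ω → E}
  {εX : ℝ≥0 → ℝ≥0} {f Vf : E → ℝ}

theorem IsWeightSequence.tendsto_div_sqrt {w : ℕ → ℝ≥0} (hw : IsWeightSequence w) {u : ℕ → ℝ}
    {K : ℝ} (hu : ∀ n, |u n| ≤ K) :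
    Tendsto (fun n => u n / √(partialSum w n : ℝ)) atTop (𝓝 0) := by
  have h1 : Tendsto (fun n => K / √(partialSum w n : ℝ)) atTop (𝓝 0) :=
    (Real.tendsto_sqrt_atTop.comp hw.tendsto_coe).const_div_atTop K
  refine squeeze_zero_norm (fun n => ?_) h1
  rw [norm_div, Real.norm_of_nonneg (Real.sqrt_nonneg _)]
  exact div_le_div_of_nonneg_right (hu n) (Real.sqrt_nonneg _)

theorem NegligibleEndpoint.tendstoInMeasure [IsFiniteMeasure μ]
    (h : NegligibleEndpoint μ γ X εX f Vf) (hw : IsWeightSequence fun n => εX (γ n))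
    (hm : ∀ n, Measurable fun ω => f (X n ω)) :
    TendstoInMeasure μ (fun (n : ℕ) ω => f (X n ω) / √(partialSum (fun k => εX (γ k)) n : ℝ))
      atTop fun _ => 0 := by
  rcases h with ⟨K, hK⟩ | h
  · exact tendstoInMeasure_of_tendsto_ae (fun n => ((hm n).div_const _).aestronglyMeasurable)
      (ae_of_all _ fun ω => hw.tendsto_div_sqrt fun n => hK _)
  · exact h.1

theorem NegligibleEndpoint.ae_tendsto (h : NegligibleEndpoint μ γ X εX f Vf)
    (hw : IsWeightSequence fun n => εX (γ n)) (hV : Vf = 0) :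
    ∀ᵐ ω ∂μ, Tendsto (fun n : ℕ => f (X n ω) / √(partialSum (fun k => εX (γ k)) n : ℝ)) atTop
      (𝓝 0) := by
  rcases h with ⟨K, hK⟩ | h
  · exact ae_of_all _ fun ω => hw.tendsto_div_sqrt fun n => hK _
  · exact h.2 hV

end Endpoint

/-! ### Fluctuations of the martingale part with the endpoint -/

/-- The martingale part of `∑ γ_k A f(X_{k-1})` together with the endpoints. -/
noncomputable def fluctuation {Ω E : Type*} [MeasurableSpace E] (Q : ℝ≥0 → Kernel E E) (γ : ℕ → ℝ≥0) (X : ℕ → Ω → E) (f : E → ℝ)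
    (n : ℕ) (ω : Ω) : ℝ :=
  ∑ k ∈ Finset.range n, centredIncrement (Q (γ (k + 1))) f (X k ω, X (k + 1) ω) +
    (f (X n ω) - f (X 0 ω))

theorem fluctuation_div {Ω E : Type*} [MeasurableSpace E] (Q : ℝ≥0 → Kernel E E) (γ : ℕ → ℝ≥0) (X : ℕ → Ω → E) (f : E → ℝ)
    (n : ℕ) (ω : Ω) (s : ℝ) :
    fluctuation Q γ X f n ω / s =
      (∑ k ∈ Finset.range n, centredIncrement (Q (γ (k + 1))) f (X k ω, X (k + 1) ω)) / s +
        f (X n ω) / s + -f (X 0 ω) / s := by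
  rw [fluctuation]
  ring

section Fluctuation

variable {Ω E : Type*} [MeasurableSpace Ω] [MeasurableSpace E] {μ : Measure Ω}
  {Q : ℝ≥0 → Kernel E E} [∀ s, IsMarkovKernel (Q s)] {γ : ℕ → ℝ≥0}
  {X : ℕ → Ω → E}

theorem IsMarkovScheme.measurable_fluctuation (hX : IsMarkovScheme μ Q γ X) {f : E → ℝ}
    (hf : Measurable f) (n : ℕ) : Measurable (fluctuation Q γ X f n) :=
  (Finset.measurable_fun_sum _ fun k _ => hX.measurable_increment hf k).add
    ((hf.comp (hX.measurable n)).sub (hf.comp (hX.measurable 0)))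

theorem IsMarkovScheme.tendstoInDistribution_fluctuation [IsProbabilityMeasure μ] [MeasurableSingletonClass E]
    (hX : IsMarkovScheme μ Q γ X)
    {f Vf : E → ℝ} (hf : Measurable f) (hfQ : ∀ n x, Integrable f (Q (γ (n + 1)) x))
    {ν : Measure E} {g : E → ℝ≥0} (hg : Measurable g) {ρ : ℝ} (hρ : ρ ∈ Set.Icc (1 : ℝ) 2)
    {εX εGC : ℝ≥0 → ℝ≥0} (hw : IsWeightSequence fun n => εX (γ n))
    (hGC : GrowthControl μ Q ν γ X g ρ εX εGC f Vf) (hSW : StepWeightCondition μ γ X g ρ εX εGC)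
    (hend : NegligibleEndpoint μ γ X εX f Vf) :
    TendstoInDistribution (fun (n : ℕ) (ω : Ω) =>
        fluctuation Q γ X f n ω / √(partialSum (fun k => εX (γ k)) n : ℝ))
      atTop (id : ℝ → ℝ) (fun _ => μ) (gaussianReal 0 (∫ x, Vf x ∂ν).toNNReal) := by
  have hm : ∀ n, Measurable fun ω => f (X n ω) := fun n => hf.comp (hX.measurable n)
  have h0 : ∀ n : ℕ, AEMeasurable
      (fun ω => -f (X 0 ω) / √(partialSum (fun k => εX (γ k)) n : ℝ)) μ := fun n =>
    ((hm 0).neg.div_const _).aemeasurable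
  have h1 := ((hX.tendstoInDistribution_sum hf hfQ hg hρ hw hGC hSW).add_of_tendstoInMeasure_const
    (hend.tendstoInMeasure hw hm) fun n => ((hm n).div_const _).aemeasurable)
    |>.add_of_tendstoInMeasure_const (c := 0)
      (tendstoInMeasure_of_tendsto_ae (fun n => (h0 n).aestronglyMeasurable)
        (ae_of_all _ fun ω => hw.tendsto_div_sqrt fun n => le_rfl)) h0
  refine h1.congr (fun n => ae_of_all _ fun ω => ?_) (ae_of_all _ fun z => ?_)
  · exact (fluctuation_div Q γ X f n ω _).symm
  · simp

theorem IsMarkovScheme.ae_tendsto_fluctuation_zero [IsProbabilityMeasure μ] (hX : IsMarkovScheme μ Q γ X)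
    {f Vf : E → ℝ} (hf : Measurable f) (hfQ : ∀ n x, Integrable f (Q (γ (n + 1)) x))
    {ν : Measure E} {g : E → ℝ≥0} (hg : Measurable g) {ρ : ℝ} (hρ : ρ ∈ Set.Icc (1 : ℝ) 2)
    {εX εGC : ℝ≥0 → ℝ≥0} (hw : IsWeightSequence fun n => εX (γ n))
    (hGC : GrowthControl μ Q ν γ X g ρ εX εGC f Vf) (hSW : StepWeightCondition μ γ X g ρ εX εGC)
    (hend : NegligibleEndpoint μ γ X εX f Vf) (hV : Vf = 0) :
    ∀ᵐ ω ∂μ, Tendsto (fun n : ℕ =>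
      fluctuation Q γ X f n ω / √(partialSum (fun k => εX (γ k)) n : ℝ)) atTop (𝓝 0) := by
  filter_upwards [hX.ae_tendsto_sum_zero hf hfQ hg hρ hw hGC hSW hV, hend.ae_tendsto hw hV]
    with ω h1 h2
  have h3 := (h1.add h2).add (hw.tendsto_div_sqrt (u := fun _ => -f (X 0 ω)) fun n => le_rfl)
  simpa only [add_zero, fluctuation_div] using h3

end Fluctuation

end ErgodicCLT

/-! ### The three regimes -/

theorem mainTheorem3
    {E Ω Ω' : Type*} [MetricSpace E] [LocallyCompactSpace E] [TopologicalSpace.SeparableSpace E]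
    [MeasurableSpace E] [BorelSpace E]
    [MeasurableSpace Ω] (μ : Measure Ω) [IsProbabilityMeasure μ]
    [MeasurableSpace Ω'] (P' : Measure Ω') [IsProbabilityMeasure P']
    -- the Feller process and its invariant distribution
    (P : ℝ≥0 → Kernel E E) (hP : ErgodicCLT.IsFellerSemigroup P)
    (ν : Measure E) [IsProbabilityMeasure ν] (hν : ∀ t, Kernel.Invariant (P t) ν)
    -- the approximation scheme
    (Q : ℝ≥0 → Kernel E E) [∀ s, IsMarkovKernel (Q s)]
    (γ : ℕ → ℝ≥0) (hγ : ErgodicCLT.IsStepSequence γ)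
    (X : ℕ → Ω → E) (hX : ErgodicCLT.IsMarkovScheme μ Q γ X)
    -- the test functions
    (F : Set (E → ℝ)) (hF : ∀ f ∈ F, f ∈ ErgodicCLT.generatorDomain P)
    (hAF : ∀ f ∈ F, Continuous (ErgodicCLT.generator P f) ∧
      ∃ K : ℝ, ∀ x, |ErgodicCLT.generator P f x| ≤ K)
    -- the data of the expansion
    (g : E → ℝ≥0) (hg : Measurable g) (ρ : ℝ) (hρ : ρ ∈ Set.Icc (1 : ℝ) 2)
    (ηt εX εGC : ℝ≥0 → ℝ≥0) (hηt : Monotone ηt) (hεX : Monotone εX) (hεGC : Monotone εGC)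
    (hηt_weight : ErgodicCLT.IsWeightSequence fun n => ηt (γ n))
    (hεX_weight : ErgodicCLT.IsWeightSequence fun n => εX (γ n))
    (M V : (E → ℝ) → (E → ℝ))
    (C : ℝ≥0) (hC : 0 < C) (η : ℕ → ℝ≥0) (hη : ∀ n, 1 ≤ n → η n = C * γ n)
    -- the assumptions
    (hexp : ∀ f ∈ F, ErgodicCLT.WeakErrorExpansion μ P' P Q ν γ X ηt f (M f))
    (hGC : ∀ f ∈ F, ErgodicCLT.GrowthControl μ Q ν γ X g ρ εX εGC f (V f))
    (hSW : ErgodicCLT.StepWeightCondition μ γ X g ρ εX εGC)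
    (hend : ∀ f ∈ F, ErgodicCLT.NegligibleEndpoint μ γ X εX f (V f)) :
    ∀ f ∈ F,
      (Tendsto (fun n => √(ErgodicCLT.partialSum (fun k => εX (γ k)) n : ℝ) /
            (ErgodicCLT.partialSum (fun k => ηt (γ k)) n : ℝ)) atTop atTop →
        TendstoInDistribution
          (fun (n : ℕ) (ω : Ω) => (ErgodicCLT.partialSum η n : ℝ) /
              ((C : ℝ) * √(ErgodicCLT.partialSum (fun k => εX (γ k)) n : ℝ)) *
            ∫ x, ErgodicCLT.generator P f x ∂(ErgodicCLT.empiricalMeasure η X n ω))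
          atTop (id : ℝ → ℝ) (fun _ => μ)
          (gaussianReal 0 (∫ x, V f x ∂ν).toNNReal)) ∧
      (∀ l : ℝ, 0 < l →
        Tendsto (fun n => √(ErgodicCLT.partialSum (fun k => εX (γ k)) n : ℝ) /
            (ErgodicCLT.partialSum (fun k => ηt (γ k)) n : ℝ)) atTop (𝓝 l) →
        TendstoInDistribution
          (fun (n : ℕ) (ω : Ω) => (ErgodicCLT.partialSum η n : ℝ) /
              ((C : ℝ) * √(ErgodicCLT.partialSum (fun k => εX (γ k)) n : ℝ)) *
            ∫ x, ErgodicCLT.generator P f x ∂(ErgodicCLT.empiricalMeasure η X n ω))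
          atTop (id : ℝ → ℝ) (fun _ => μ)
          (gaussianReal (l⁻¹ * ∫ x, M f x ∂ν) (∫ x, V f x ∂ν).toNNReal)) ∧
      (Tendsto (fun n => √(ErgodicCLT.partialSum (fun k => εX (γ k)) n : ℝ) /
            (ErgodicCLT.partialSum (fun k => ηt (γ k)) n : ℝ)) atTop (𝓝 0) →
        TendstoInMeasure μ
          (fun (n : ℕ) (ω : Ω) => (ErgodicCLT.partialSum η n : ℝ) /
              ((C : ℝ) * (ErgodicCLT.partialSum (fun k => ηt (γ k)) n : ℝ)) *
            ∫ x, ErgodicCLT.generator P f x ∂(ErgodicCLT.empiricalMeasure η X n ω))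
          atTop (fun _ => ∫ x, M f x ∂ν) ∧
        (V f = 0 → ∀ᵐ ω ∂μ, Tendsto
          (fun n : ℕ => (ErgodicCLT.partialSum η n : ℝ) /
              ((C : ℝ) * (ErgodicCLT.partialSum (fun k => ηt (γ k)) n : ℝ)) *
            ∫ x, ErgodicCLT.generator P f x ∂(ErgodicCLT.empiricalMeasure η X n ω))
          atTop (𝓝 (∫ x, M f x ∂ν)))) := by
  intro f hfF
  have hf : Measurable f := (hF f hfF).1
  have hfQ : ∀ n x, Integrable f (Q (γ (n + 1)) x) := fun n x =>
    (hexp f hfF).integrable_Q _ (hγ.mem_Ioc n) x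
  have hfA : Measurable (ErgodicCLT.generator P f) := (hAF f hfF).1.measurable
  have hT := hX.tendstoInDistribution_fluctuation hf hfQ hg hρ hεX_weight (hGC f hfF) hSW
    (hend f hfF)
  have hR := (hexp f hfF).ae_tendsto hγ hηt_weight
  have ht : ∀ᶠ n in atTop, (0 : ℝ) < ErgodicCLT.partialSum (fun k => ηt (γ k)) n :=
    hηt_weight.tendsto_coe.eventually_gt_atTop 0
  have hh : ∀ᶠ n in atTop, (0 : ℝ) < √(ErgodicCLT.partialSum (fun k => εX (γ k)) n : ℝ) :=
    (Real.tendsto_sqrt_atTop.comp hεX_weight.tendsto_coe).eventually_gt_atTop 0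
  -- By the decomposition, the sum of remainders is the generator sum minus the fluctuation. Both
  -- are measurable, the former by continuity of `A f`.
  have hmB : ∀ n, Measurable fun ω => ∑ k ∈ Finset.range n,
      -ErgodicCLT.remainder P Q f (X k ω) (γ (k + 1)) := fun n => by
    have h1 : ∀ k, Measurable fun ω => ErgodicCLT.generator P f (X k ω) := fun k =>
      hfA.comp (hX.measurable k)
    have h2 := hX.measurable_fluctuation hf n
    have h3 : Measurable fun ω =>
        ∑ k ∈ Finset.range n, (γ (k + 1) : ℝ) * ErgodicCLT.generator P f (X k ω) -
          ErgodicCLT.fluctuation Q γ X f n ω := by fun_prop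
    convert h3 using 2 with ω
    rw [ErgodicCLT.sum_generator_eq P Q hγ f (fun k => X k ω) n, ErgodicCLT.fluctuation]
    ring
  simp only [ErgodicCLT.partialSum_div_mul_integral_generator hC hη,
    fun n ω => ErgodicCLT.sum_generator_eq P Q hγ f (fun k => X k ω) n]
  -- convergence in law, with a drift
  have hlaw : ∀ c : ℝ, Tendsto (fun n => (ErgodicCLT.partialSum (fun k => ηt (γ k)) n : ℝ) /
        √(ErgodicCLT.partialSum (fun k => εX (γ k)) n : ℝ)) atTop (𝓝 c) →
      TendstoInDistribution (fun (n : ℕ) (ω : Ω) =>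
          (∑ k ∈ Finset.range n,
              ErgodicCLT.centredIncrement (Q (γ (k + 1))) f (X k ω, X (k + 1) ω) +
            (f (X n ω) - f (X 0 ω)) +
            ∑ k ∈ Finset.range n, -ErgodicCLT.remainder P Q f (X k ω) (γ (k + 1))) /
          √(ErgodicCLT.partialSum (fun k => εX (γ k)) n : ℝ))
        atTop (id : ℝ → ℝ) (fun _ => μ)
        (gaussianReal (c * ∫ x, M f x ∂ν) (∫ x, V f x ∂ν).toNNReal) := by
    intro c hc
    have hmR : ∀ n : ℕ, Measurable fun ω =>
        (∑ k ∈ Finset.range n, -ErgodicCLT.remainder P Q f (X k ω) (γ (k + 1))) /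
          √(ErgodicCLT.partialSum (fun k => εX (γ k)) n : ℝ) := fun n => (hmB n).div_const _
    have h1 : ∀ᵐ ω ∂μ, Tendsto (fun n : ℕ =>
        (∑ k ∈ Finset.range n, -ErgodicCLT.remainder P Q f (X k ω) (γ (k + 1))) /
          √(ErgodicCLT.partialSum (fun k => εX (γ k)) n : ℝ)) atTop
        (𝓝 (c * ∫ x, M f x ∂ν)) := by
      filter_upwards [hR] with ω hω
      refine (hc.mul hω).congr' ?_
      filter_upwards [ht] with n hn
      field_simp
    have h2 := hT.add_of_tendstoInMeasure_const
      (tendstoInMeasure_of_tendsto_ae (fun n => (hmR n).aestronglyMeasurable) h1)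
      fun n => (hmR n).aemeasurable
    have h3 := ErgodicCLT.tendstoInDistribution_of_map_eq
      (μ₂ := gaussianReal (c * ∫ x, M f x ∂ν) (∫ x, V f x ∂ν).toNNReal) (Z₂ := id) h2
      aemeasurable_id (by
        rw [Measure.map_id]
        simpa using gaussianReal_map_add_const (μ := 0) (v := (∫ x, V f x ∂ν).toNNReal)
          (c * ∫ x, M f x ∂ν))
    refine h3.congr (fun n => ae_of_all _ fun ω => ?_) (ae_of_all _ fun z => rfl)
    simp only [Pi.add_apply, ← add_div]
    rfl
  refine ⟨fun hl => ?_, fun l hl hlim => ?_, fun hl => ⟨?_, fun hV => ?_⟩⟩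
  · have := hlaw 0 (by simpa [Function.comp_def] using tendsto_inv_atTop_zero.comp hl)
    rwa [zero_mul] at this
  · exact hlaw l⁻¹ (by simpa using hlim.inv₀ hl.ne')
  · have hmR : ∀ n : ℕ, Measurable fun ω =>
        (∑ k ∈ Finset.range n, -ErgodicCLT.remainder P Q f (X k ω) (γ (k + 1))) /
          (ErgodicCLT.partialSum (fun k => ηt (γ k)) n : ℝ) := fun n => (hmB n).div_const _
    -- The fluctuation divided by `H'` is a sequence converging in law times `√H / H' → 0`. The
    -- limit in law of the whole expression is then constant, which upgrades the convergence to
    -- convergence in probability.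
    have h1 := hT.continuous_comp_prodMk_of_tendstoInMeasure_const (g := fun z : ℝ × ℝ => z.2 * z.1)
      (Y := fun (n : ℕ) _ => √(ErgodicCLT.partialSum (fun k => εX (γ k)) n : ℝ) /
            (ErgodicCLT.partialSum (fun k => ηt (γ k)) n : ℝ)) (c := 0) (by fun_prop)
      (tendstoInMeasure_of_tendsto_ae (fun n => aestronglyMeasurable_const) (ae_of_all _ fun _ => hl))
      fun n => aemeasurable_const
    have h2 := h1.add_of_tendstoInMeasure_const
      (tendstoInMeasure_of_tendsto_ae (fun n => (hmR n).aestronglyMeasurable) hR)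
      fun n => (hmR n).aemeasurable
    simp only [zero_mul, zero_add] at h2
    refine (ErgodicCLT.tendstoInMeasure_of_tendstoInDistribution_const h2).congr' ?_ .rfl
    filter_upwards [ht, hh] with n hn1 hn2
    refine ae_of_all _ fun ω => ?_
    simp only [Pi.add_apply, ErgodicCLT.fluctuation]
    field_simp
  · filter_upwards [hR, hX.ae_tendsto_fluctuation_zero hf hfQ hg hρ hεX_weight (hGC f hfF) hSW
      (hend f hfF) hV] with ω h1 h2
    have h3 := (hl.mul h2).add h1
    rw [zero_mul, zero_add] at h3
    refine h3.congr' ?_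
    filter_upwards [ht, hh] with n hn1 hn2
    simp only [ErgodicCLT.fluctuation]
    field_simp
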